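/- Let $\mathcal A$ be a finite alphabet with $|\mathcal A|\ge 2$ and let $(p_\alpha)_{\alpha\in\mathcal A}$ be a probability vector with every $p_\alpha>0$. Let $H=-\sum_\alpha p_\alpha\ln p_\alpha$, and let $d_{\mathcal A}$ be the largest $d>0$ such that $\ln p_\alpha\in d\mathbb Z$ for all $\alpha\in\mathcal A$, with $d_{\mathcal A}:=0$ if there is no such $d$. Let $\Xi^{(1)},\Xi^{(2)},\dots$ be infinite random strings whose letters are all independent with distribution $(p_\alpha)$ and, for $\lambda>0$, let $N_\lambda\sim\mathrm{Po}(\lambda)$ be independent of the strings. Let $T_\lambda$ be the trie constructed from $\Xi^{(1)},\dots,\Xi^{(N_\lambda)}$: its nodes are the finite strings $w$ that are a prefix of at least two of these strings, and those $w$ that are a prefix of exactly one of them and are either the empty string (the root) or have a parent that is a prefix of at least two of them. (The parent of a nonempty finite string is obtained by deleting its last letter.) Let $|T|_{\mathrm i}$ be the number of internal nodes of a tree $T$, i.e. of nodes that have a child in $T$; let $\varphi(T)$ be $1$ if the root is an internal node of $T$ and $0$ otherwise; let $\chi=\varphi(\bullet)$, where $\bullet$ is the tree consisting of the root only; and let $f_{\mathrm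 E}(\lambda)=\mathbb E\,\varphi(T_\lambda)-\chi\lambda e^{-\lambda}$. Assume that $d_{\mathcal A}=0$. Then: 1. For every $\lambda>0$, $T_\lambda$ is almost surely finite and $\mathbb E|T_\lambda|_{\mathrm i}<\infty$. 2. $\chi=0$ and $\int_0^\infty f_{\mathrm E}(x)\,x^{-2}\,dx=1$, with absolute convergence. 3. Define $R$ on $(0,\infty)$ by $$\frac{\mathbb E|T_\lambda|_{\mathrm i}}{\lambda}=\frac1H+R(\lambda).$$ Then $R(\lambda)\to0$ as $\lambda\to\infty$. 4. There is a constant $C<\infty$ such that there are arbitrarily large $\lambda$ with $$|R(\lambda)|>\exp\left(-C(\ln\lambda)^{(|\mathcal A|-1)/(|\mathcal A|+1)}\right).$$ 5. For every $\varepsilon>0$, it is not the case that $R(\lambda)=O(\lambda^{-\varepsilon})$ as $\lambda\to\infty$. -/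

import Mathlib

open MeasureTheory ProbabilityTheory Filter Asymptotics
open scoped Topology

noncomputable section

namespace RandomTrie

/-- The entropy `H = -∑ pₐ ln pₐ` of a probability vector. -/
def entropy {A : Type*} [Fintype A] (p : A → ℝ) : ℝ :=
  -∑ a, p a * Real.log (p a)

/-- The greatest common divisor of a set `S` of real numbers: the largest `d > 0` such that
`S ⊆ d ℤ`, and `0` if there is no such `d` (the supremum of the empty set of reals is `0`).
It is used for sets that contain a nonzero element; the supremum is then attained
as soon as some such `d` exists. -/
def realGcd (S : Set ℝ) : ℝ :=
  sSup {d : ℝ | 0 < d ∧ ∀ x ∈ S, ∃ k : ℤ, x = k * d}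

/-- `d_A`, the greatest common divisor of the numbers `-ln pₐ`. -/
def period {A : Type*} (p : A → ℝ) : ℝ :=
  realGcd (Set.range fun a => -Real.log (p a))

/-- The finite string `v` is a prefix of the infinite string `x`. -/
def IsPrefixOf {A : Type*} (v : List A) (x : ℕ → A) : Prop :=
  ∀ (i : ℕ) (hi : i < v.length), v[i] = x i

/-- The number of strings among the first `n` strings `x 0, …, x (n-1)` that have prefix `v`. -/
def prefixCount {A : Type*} (x : ℕ → ℕ → A) (n : ℕ) (v : List A) : ℕ :=
  Set.ncard {k : ℕ | k < n ∧ IsPrefixOf v (x k)}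

/-- The trie generated by the `n` strings `x 0, …, x (n-1)`, as a set of nodes of the infinite
tree of all finite strings. A node belongs to it if at least two strings pass through it, or if
exactly one string does and the node is the root or at least two strings pass through its parent.
(For `n = 0` this is the empty tree.) -/
def trie {A : Type*} (x : ℕ → ℕ → A) (n : ℕ) : Set (List A) :=
  {v | 2 ≤ prefixCount x n v ∨
    (prefixCount x n v = 1 ∧ (v = [] ∨ 2 ≤ prefixCount x n v.dropLast))}

/-- The internal nodes of a tree: the nodes that have a child in the tree. -/
def internalNodes {A : Type*} (T : Set (List A)) : Set (List A) :=
  {v | v ∈ T ∧ ∃ a : A, v ++ [a] ∈ T}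

/-- The size `|T|ᵢ` of a (finite) tree: its number of internal nodes. -/
def size {A : Type*} (T : Set (List A)) : ℕ := (internalNodes T).ncard

open Classical in
/-- The toll function of the size: the indicator that the root is an internal node. -/
def sizeToll {A : Type*} (T : Set (List A)) : ℝ :=
  if ([] : List A) ∈ internalNodes T then 1 else 0

/-- The tree `•` that consists of the root only. -/
def rootTree (A : Type*) : Set (List A) := {[]}

/-- `χ`, the value of the toll function of the size at the tree `•`. -/
def chi (A : Type*) : ℝ := sizeToll (rootTree A)

/-- The trie `T_N` generated by the first `N` of the random strings
`Ξ⁽ᵏ⁾ = ξ k 0, ξ k 1, ξ k 2, …`, where `N` is random. -/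
def randomTrie {A Ω : Type*} (ξ : ℕ → ℕ → Ω → A) (N : Ω → ℕ) (ω : Ω) : Set (List A) :=
  trie (fun k i => ξ k i ω) (N ω)

/-- The function `f_E(t) = E φ(T_t) - χ t e^{-t}`, with `φ` the toll function of the size. -/
def tollMean {A Ω : Type*} [MeasurableSpace Ω] (μ : Measure Ω) (ξ : ℕ → ℕ → Ω → A)
    (N : ℝ → Ω → ℕ) (t : ℝ) : ℝ :=
  (∫ ω, sizeToll (randomTrie ξ (N t) ω) ∂μ) - chi A * t * Real.exp (-t)

end RandomTrie

end

/-! A node is internal exactly when at least two strings pass through it, and Poisson thinning makes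
that number `Po(λ P(v))`, with `P(v)` the product of the letter probabilities. So the mean size is
M(λ) = ∑_v g(λ P(v)) with g(x) = 1 - (1 + x)e^{-x} (`meanSize`, `poissonTail`), and splitting off
the first letter gives the renewal equation M(t) = g(t) + ∑ₐ M(pₐ t).

Everything rests on a truncated Mellin identity (`sum_integral_meanSize`). If ∑ₐ pₐ^{1+ρ} = 1 and Re
ρ < 1, multiplying the renewal equation by t^{-2-ρ} and integrating over (0, x) cancels all of M
except on the windows [pₐ x, x]: ∑ₐ pₐ^{1+ρ} ∫_{pₐ x}^x t^{-2-ρ} M(t) dt = ∫_0^x t^{-2-ρ} g(t) dt.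
As x → ∞ the right side tends to Γ(1-ρ)/(1+ρ) when also Re ρ > -1. No inverse transform or contour
shift is needed.

With ρ = 0 the identity bounds M(t)/t and normalizes its limit; a renewal theorem proved from
ultrafilter limits (`tendsto_of_renewal`) then gives M(t)/t → 1/H in the non-lattice case.

With ρ a nonreal root, the constant 1/H contributes nothing to the left side, so only R is left to
balance a quantity of size at least about e^{-4 Im ρ}. Put n = |A| - 1. Dirichlet approximation
produces roots with y = Im ρ arbitrarily large and Re ρ ≥ -C y^{-2/n} (`exists_root_near_line`).
Taking ln x = y^{1+2/n} keeps the growth factor x^{-Re ρ} at most e^{O(y)}, so |R| exceeds e^{-O(y)}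
somewhere on the windows, where y is comparable to (ln t)^{n/(n+2)}. This is the exponent
(|A|-1)/(|A|+1); being less than 1, it rules out power decay. -/

namespace RandomTrie

/-! ### The probability that a Poisson variable is at least two -/

/-- The probability that a Poisson variable with mean `x` is at least two. -/
noncomputable def poissonTail (x : ℝ) : ℝ := 1 - (1 + x) * Real.exp (-x)

lemma hasDerivAt_poissonTail (x : ℝ) : HasDerivAt poissonTail (x * Real.exp (-x)) x := by
  have h1 : HasDerivAt (fun x : ℝ => Real.exp (-x)) (-Real.exp (-x)) x := by
    simpa using (hasDerivAt_neg x).exp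
  have h := (((hasDerivAt_id x).const_add 1).mul h1).const_sub 1
  refine h.congr_deriv ?_
  simp only [id]; ring

lemma continuous_poissonTail : Continuous poissonTail := by
  unfold poissonTail; fun_prop

lemma poissonTail_zero : poissonTail 0 = 0 := by simp [poissonTail]

lemma poissonTail_monotoneOn : MonotoneOn poissonTail (Set.Ici 0) := by
  refine monotoneOn_of_deriv_nonneg (convex_Ici 0) continuous_poissonTail.continuousOn
    (fun x _ => (hasDerivAt_poissonTail x).differentiableAt.differentiableWithinAt) fun x hx => ?_
  rw [interior_Ici] at hx
  rw [(hasDerivAt_poissonTail x).deriv]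
  have : 0 < x := hx
  positivity

lemma poissonTail_nonneg {x : ℝ} (hx : 0 ≤ x) : 0 ≤ poissonTail x := by
  simpa [poissonTail_zero] using poissonTail_monotoneOn (Set.mem_Ici.2 le_rfl) hx hx

lemma poissonTail_le_one {x : ℝ} (hx : 0 ≤ x) : poissonTail x ≤ 1 := by
  unfold poissonTail
  have : 0 ≤ (1 + x) * Real.exp (-x) := by positivity
  linarith

lemma poissonTail_le_sq {x : ℝ} (hx : 0 ≤ x) : poissonTail x ≤ x ^ 2 := by
  unfold poissonTail
  have h := Real.add_one_le_exp (-x)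
  nlinarith

/-- The difference of the two sides vanishes at 0 and has derivative c²y(e^{-y} - e^{-cy}) ≥ 0.
Inherited by `meanSize`, this limits how fast it can grow and replaces any estimate of its
derivative. -/
lemma poissonTail_mul_le {c x : ℝ} (hc : 1 ≤ c) (hx : 0 ≤ x) :
    poissonTail (c * x) ≤ c ^ 2 * poissonTail x := by
  have hd (y : ℝ) : HasDerivAt (fun x => c ^ 2 * poissonTail x - poissonTail (c * x))
      (c ^ 2 * (y * (Real.exp (-y) - Real.exp (-(c * y))))) y := by
    have h1 : HasDerivAt (fun x => poissonTail (c * x)) (c * y * Real.exp (-(c * y)) * c) y := by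
      refine (hasDerivAt_poissonTail (c * y)).comp y ?_
      simpa using (hasDerivAt_id y).const_mul c
    refine (((hasDerivAt_poissonTail y).const_mul (c ^ 2)).sub h1).congr_deriv ?_
    ring
  have hm : MonotoneOn (fun x => c ^ 2 * poissonTail x - poissonTail (c * x)) (Set.Ici 0) := by
    refine monotoneOn_of_deriv_nonneg (convex_Ici 0)
      (fun y _ => (hd y).continuousAt.continuousWithinAt)
      (fun y _ => (hd y).differentiableAt.differentiableWithinAt) fun y hy => ?_
    rw [interior_Ici] at hy
    have hy : 0 < y := hy
    rw [(hd y).deriv]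
    have : Real.exp (-(c * y)) ≤ Real.exp (-y) := Real.exp_le_exp.2 (by nlinarith)
    have := sub_nonneg.2 this
    positivity
  have := hm (Set.mem_Ici.2 le_rfl) hx hx
  simp only [mul_zero, poissonTail_zero, sub_zero] at this
  linarith

/-! ### Sums over finite strings -/

section Strings

variable {A : Type*}

/-- A string is empty or has a first letter. -/
def unitSumProdListEquiv (A : Type*) : Unit ⊕ A × List A ≃ List A where
  toFun := Sum.elim (fun _ => []) fun x => x.1 :: x.2
  invFun l := match l with
    | [] => Sum.inl ()
    | a :: l => Sum.inr (a, l)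
  left_inv o := by cases o <;> rfl
  right_inv l := by cases l <;> rfl

/-- The probability that a random string starts with `v`. -/
def stringProb (p : A → ℝ) (v : List A) : ℝ := (v.map p).prod

lemma stringProb_nil (p : A → ℝ) : stringProb p [] = 1 := rfl

lemma stringProb_cons (p : A → ℝ) (a : A) (v : List A) :
    stringProb p (a :: v) = p a * stringProb p v := by simp [stringProb]

variable {p : A → ℝ}

lemma stringProb_pos (hp : ∀ a, 0 < p a) (v : List A) : 0 < stringProb p v := by
  induction v with
  | nil => simp [stringProb]
  | cons a v ih => rw [stringProb_cons]; exact mul_pos (hp a) ih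

/-- The mean number of finite strings that are prefixes of at least two of `Po(t)` strings. -/
noncomputable def meanSize (p : A → ℝ) (t : ℝ) : ℝ :=
  ∑' v : List A, poissonTail (t * stringProb p v)

lemma meanSize_nonneg (hp : ∀ a, 0 < p a) {t : ℝ} (ht : 0 ≤ t) : 0 ≤ meanSize p t :=
  tsum_nonneg fun v => poissonTail_nonneg (mul_nonneg ht (stringProb_pos hp v).le)

variable [Fintype A]

lemma lt_one_of_sum_eq_one [Nontrivial A] (hp : ∀ a, 0 < p a) (hs : ∑ a, p a = 1) (a : A) :
    p a < 1 := by
  obtain ⟨b, hb⟩ := exists_ne a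
  rw [← hs]
  exact Finset.single_lt_sum hb (Finset.mem_univ a) (Finset.mem_univ b) (hp b)
    fun c _ _ => (hp c).le

/-- Strings of length n contribute (∑ pₐ²)^n, a geometric term with ratio below ∑ pₐ = 1. Since g(x)
≤ x², this gives convergence of `meanSize`. -/
lemma summable_stringProb_sq [Nontrivial A] (hp : ∀ a, 0 < p a) (hs : ∑ a, p a = 1) :
    Summable fun v : List A => stringProb p v ^ 2 := by
  rw [← (List.equivSigmaTuple (α := A)).symm.summable_iff]
  have hval (n : ℕ) (v : Fin n → A) :
      stringProb p (List.equivSigmaTuple.symm ⟨n, v⟩) = ∏ i, p (v i) := by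
    simp [stringProb, List.equivSigmaTuple, List.map_ofFn, List.prod_ofFn]
  have hsum (n : ℕ) : ∑ v : Fin n → A, (∏ i, p (v i)) ^ 2 = (∑ a, p a ^ 2) ^ n := by
    classical
    simp_rw [← Finset.prod_pow]
    rw [← Fintype.piFinset_univ, Finset.sum_prod_piFinset Finset.univ fun _ a => p a ^ 2]
    simp
  refine (summable_sigma_of_nonneg fun _ => sq_nonneg _).2 ⟨fun n => Summable.of_finite, ?_⟩
  simp only [tsum_fintype]
  simp_rw [hval, hsum]
  refine summable_geometric_of_lt_one (Finset.sum_nonneg fun a _ => sq_nonneg _) ?_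
  rw [← hs]
  refine Finset.sum_lt_sum_of_nonempty Finset.univ_nonempty fun a _ => ?_
  have := lt_one_of_sum_eq_one hp hs a
  have := hp a
  nlinarith

variable [Nontrivial A]

lemma summable_poissonTail (hp : ∀ a, 0 < p a) (hs : ∑ a, p a = 1) {t : ℝ} (ht : 0 ≤ t) :
    Summable fun v : List A => poissonTail (t * stringProb p v) := by
  have hv (v : List A) : 0 ≤ t * stringProb p v := mul_nonneg ht (stringProb_pos hp v).le
  refine Summable.of_nonneg_of_le (fun v => poissonTail_nonneg (hv v))
    (fun v => poissonTail_le_sq (hv v)) ?_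
  simp_rw [mul_pow]
  exact (summable_stringProb_sq hp hs).mul_left _

lemma meanSize_le_sq (hp : ∀ a, 0 < p a) (hs : ∑ a, p a = 1) {t : ℝ} (ht : 0 ≤ t) :
    meanSize p t ≤ (∑' v : List A, stringProb p v ^ 2) * t ^ 2 := by
  rw [mul_comm, ← tsum_mul_left]
  refine (summable_poissonTail hp hs ht).tsum_le_tsum (fun v => ?_)
    ((summable_stringProb_sq hp hs).mul_left _)
  rw [← mul_pow]
  exact poissonTail_le_sq (mul_nonneg ht (stringProb_pos hp v).le)

lemma meanSize_monotoneOn (hp : ∀ a, 0 < p a) (hs : ∑ a, p a = 1) :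
    MonotoneOn (meanSize p) (Set.Ici 0) := by
  intro t ht t' ht' htt
  refine (summable_poissonTail hp hs ht).tsum_le_tsum (fun v => ?_) (summable_poissonTail hp hs ht')
  have hv := (stringProb_pos hp v).le
  exact poissonTail_monotoneOn (mul_nonneg ht hv) (mul_nonneg ht' hv)
    (mul_le_mul_of_nonneg_right htt hv)

lemma meanSize_mul_le (hp : ∀ a, 0 < p a) (hs : ∑ a, p a = 1) {c t : ℝ} (hc : 1 ≤ c)
    (ht : 0 ≤ t) : meanSize p (c * t) ≤ c ^ 2 * meanSize p t := by
  unfold meanSize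
  rw [← tsum_mul_left]
  refine (summable_poissonTail hp hs (by positivity)).tsum_le_tsum (fun v => ?_)
    ((summable_poissonTail hp hs ht).mul_left _)
  rw [mul_assoc]
  exact poissonTail_mul_le hc (mul_nonneg ht (stringProb_pos hp v).le)

/-- The renewal equation: the empty string gives the toll, and the strings with first letter `a`
form a copy of the whole tree at intensity `p a * t`. -/
lemma meanSize_eq (hp : ∀ a, 0 < p a) (hs : ∑ a, p a = 1) {t : ℝ} (ht : 0 ≤ t) :
    meanSize p t = poissonTail t + ∑ a, meanSize p (p a * t) := by
  have h := summable_poissonTail hp hs ht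
  rw [← (unitSumProdListEquiv A).summable_iff] at h
  have hr := h.comp_injective (Sum.inr_injective (α := Unit))
  unfold meanSize
  rw [← (unitSumProdListEquiv A).tsum_eq]
  refine (Summable.tsum_sum (h.comp_injective (Sum.inl_injective (β := A × List A))) hr).trans ?_
  congr 1
  · simp [unitSumProdListEquiv, stringProb]
  · refine hr.tsum_prod.trans ?_
    rw [tsum_fintype]
    refine Finset.sum_congr rfl fun a _ => tsum_congr fun v => ?_
    simp only [Function.comp_apply, unitSumProdListEquiv, Equiv.coe_fn_mk, Sum.elim_inr,
      stringProb_cons]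
    ring_nf

lemma aemeasurable_meanSize (hp : ∀ a, 0 < p a) (hs : ∑ a, p a = 1) :
    AEMeasurable (meanSize p) (volume.restrict (Set.Ioi 0)) :=
  aemeasurable_restrict_of_monotoneOn measurableSet_Ioi
    ((meanSize_monotoneOn hp hs).mono Set.Ioi_subset_Ici_self)

end Strings

/-! ### The Mellin transform of the Poisson tail -/

lemma mellinConvergent_poissonTail {ρ : ℂ} (h1 : -1 < ρ.re) (h2 : ρ.re < 1) :
    MellinConvergent (fun t : ℝ => (poissonTail t : ℂ)) (-1 - ρ) := by
  refine mellinConvergent_of_isBigO_rpow (a := 0) (b := -2) ?_ ?_ ?_ ?_ ?_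
  · exact (Complex.continuous_ofReal.comp continuous_poissonTail).continuousOn.locallyIntegrableOn
      measurableSet_Ioi
  · refine IsBigO.of_bound 1 ?_
    filter_upwards [eventually_ge_atTop 0] with t ht
    simpa [abs_of_nonneg (poissonTail_nonneg ht)] using poissonTail_le_one ht
  · simp; linarith
  · refine IsBigO.of_bound 1 ?_
    filter_upwards [self_mem_nhdsWithin] with t ht
    have ht : 0 < t := ht
    simpa [abs_of_nonneg (poissonTail_nonneg ht.le)] using poissonTail_le_sq ht.le
  · simp; linarith

lemma integrableOn_poissonTail {ρ : ℂ} (h1 : -1 < ρ.re) (h2 : ρ.re < 1) :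
    IntegrableOn (fun t : ℝ => (t : ℂ) ^ (-2 - ρ) * poissonTail t) (Set.Ioi 0) := by
  have h := mellinConvergent_poissonTail h1 h2
  have e : (-1 - ρ - 1 : ℂ) = -2 - ρ := by ring
  simpa only [MellinConvergent, e, smul_eq_mul] using! h

lemma one_add_ne_zero_of_neg_one_lt_re {ρ : ℂ} (h1 : -1 < ρ.re) : 1 + ρ ≠ 0 := by
  intro h
  have := congrArg Complex.re h
  simp at this
  linarith

/-- Integration by parts with g'(t) = t e^{-t} reduces the integral to Euler's integral for Γ(1-ρ).
-/
lemma integral_poissonTail {ρ : ℂ} (h1 : -1 < ρ.re) (h2 : ρ.re < 1) :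
    ∫ t : ℝ in Set.Ioi 0, (t : ℂ) ^ (-2 - ρ) * poissonTail t = Complex.Gamma (1 - ρ) / (1 + ρ) := by
  have hρ := one_add_ne_zero_of_neg_one_lt_re h1
  have hre : 0 < (1 - ρ).re := by simp; linarith
  have hG := Complex.GammaIntegral_convergent hre
  have hI := integrableOn_poissonTail h1 h2
  -- The boundary term of the integration by parts. It vanishes at 0 because g(t) ≤ t² and Re ρ < 1,
  -- and at infinity because g ≤ 1 and Re ρ > -1.
  set F : ℝ → ℂ := fun t => -(poissonTail t * (t : ℂ) ^ (-1 - ρ)) / (1 + ρ) with hF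
  have hderiv (t : ℝ) (ht : t ∈ Set.Ioi (0 : ℝ)) : HasDerivAt F ((t : ℂ) ^ (-2 - ρ) * poissonTail t -
      (Real.exp (-t) * (t : ℂ) ^ (1 - ρ - 1)) / (1 + ρ)) t := by
    have ht : 0 < t := ht
    have ht' : (t : ℂ) ≠ 0 := Complex.ofReal_ne_zero.2 ht.ne'
    have hne : (-1 - ρ) ≠ 0 := fun h => hρ (by linear_combination -h)
    have hc := hasDerivAt_ofReal_cpow_const' (r := -2 - ρ) ht.ne'
      (fun h => hρ (by linear_combination -h))
    have e1 : -2 - ρ + 1 = -1 - ρ := by ring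
    rw [e1] at hc
    have h := (((hasDerivAt_poissonTail t).ofReal_comp.mul
      (hc.mul_const (-1 - ρ))).neg).div_const (1 + ρ)
    have hfun : (fun y : ℝ => (y : ℂ) ^ (-1 - ρ) / (-1 - ρ) * (-1 - ρ)) =
        fun y : ℝ => (y : ℂ) ^ (-1 - ρ) := by
      ext y; field_simp
    rw [hfun] at h
    refine h.congr_deriv ?_
    have e2 : (t : ℂ) ^ (-1 - ρ) * t = (t : ℂ) ^ (1 - ρ - 1) := by
      rw [show 1 - ρ - 1 = -1 - ρ + 1 by ring, Complex.cpow_add _ _ ht', Complex.cpow_one]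
    rw [← e2]
    push_cast
    field_simp
    ring
  have hbound (t : ℝ) (ht : 0 ≤ t) : ‖F t‖ ≤ t ^ (1 - ρ.re) / ‖1 + ρ‖ := by
    rw [hF]
    simp only [norm_div, norm_neg, norm_mul, Complex.norm_real, Real.norm_eq_abs]
    gcongr
    rcases ht.eq_or_lt with rfl | ht
    · simp [poissonTail_zero]
      positivity
    · rw [abs_of_nonneg (poissonTail_nonneg ht.le), Complex.norm_cpow_eq_rpow_re_of_pos ht]
      calc _ ≤ t ^ 2 * t ^ (-1 - ρ).re := by
            gcongr; exact poissonTail_le_sq ht.le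
        _ = t ^ (1 - ρ.re) := by
            rw [← Real.rpow_natCast, ← Real.rpow_add ht]; congr 1; simp; ring
  have hF0 : F 0 = 0 := by simp [hF, poissonTail_zero]
  have hcont : ContinuousWithinAt F (Set.Ici 0) 0 := by
    rw [ContinuousWithinAt, hF0]
    refine squeeze_zero_norm' (a := fun t => t ^ (1 - ρ.re) / ‖1 + ρ‖) ?_ ?_
    · filter_upwards [self_mem_nhdsWithin] with t ht using hbound t ht
    · have : ContinuousAt (fun t : ℝ => t ^ (1 - ρ.re) / ‖1 + ρ‖) 0 :=
        (Real.continuousAt_rpow_const _ _ (Or.inr (by linarith))).div_const _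
      have h := this.tendsto
      rw [Real.zero_rpow (by linarith), zero_div] at h
      exact h.mono_left nhdsWithin_le_nhds
  have hlim : Tendsto F atTop (𝓝 0) := by
    refine squeeze_zero_norm' (a := fun t => t ^ (-(1 + ρ.re)) / ‖1 + ρ‖) ?_ ?_
    · filter_upwards [eventually_gt_atTop 0] with t ht
      rw [hF]
      simp only [norm_div, norm_neg, norm_mul, Complex.norm_real, Real.norm_eq_abs]
      gcongr
      rw [abs_of_nonneg (poissonTail_nonneg ht.le), Complex.norm_cpow_eq_rpow_re_of_pos ht]
      calc _ ≤ 1 * t ^ (-1 - ρ).re := by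
            gcongr; exact poissonTail_le_one ht.le
        _ = t ^ (-(1 + ρ.re)) := by rw [one_mul]; congr 1; simp; ring
    · simpa using (tendsto_rpow_neg_atTop (y := 1 + ρ.re) (by linarith)).div_const ‖1 + ρ‖
  have hint := integral_Ioi_of_hasDerivAt_of_tendsto hcont hderiv
    (hI.sub (hG.div_const (1 + ρ))) hlim
  rw [integral_sub hI (hG.div_const (1 + ρ)), integral_div, hF0, sub_zero, sub_eq_zero] at hint
  rw [hint, Complex.Gamma_eq_integral hre, Complex.GammaIntegral]

lemma hasMellin_poissonTail : HasMellin (fun t : ℝ => (poissonTail t : ℂ)) (-1) 1 := by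
  have h := mellinConvergent_poissonTail (ρ := 0) (by simp) (by simp)
  have hi := integral_poissonTail (ρ := 0) (by simp) (by simp)
  rw [sub_zero] at h
  refine ⟨h, ?_⟩
  rw [mellin]
  have e : (-1 - 1 : ℂ) = -2 - 0 := by norm_num
  simp_rw [e, smul_eq_mul]
  rw [hi]; simp

lemma norm_Gamma_le {z : ℂ} (hz : 0 < z.re) : ‖Complex.Gamma z‖ ≤ Real.Gamma z.re := by
  rw [Complex.Gamma_eq_integral hz, Real.Gamma_eq_integral hz, Complex.GammaIntegral]
  refine (norm_integral_le_integral_norm _).trans (le_of_eq ?_)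
  refine setIntegral_congr_fun measurableSet_Ioi fun t ht => ?_
  have ht : 0 < t := ht
  simp [Complex.norm_cpow_eq_rpow_re_of_pos ht, Complex.norm_exp]

lemma norm_sin_le (z : ℂ) : ‖Complex.sin z‖ ≤ Real.exp |z.im| := by
  rw [Complex.sin]
  simp only [norm_div, norm_mul, Complex.norm_I, mul_one, Complex.norm_ofNat]
  have h1 : ‖Complex.exp (-z * Complex.I)‖ ≤ Real.exp |z.im| := by
    rw [Complex.norm_exp]; simpa using le_abs_self z.im
  have h2 : ‖Complex.exp (z * Complex.I)‖ ≤ Real.exp |z.im| := by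
    rw [Complex.norm_exp]; simpa using neg_le_abs z.im
  have := norm_sub_le (Complex.exp (-z * Complex.I)) (Complex.exp (z * Complex.I))
  linarith

/-- By the reflection formula, Γ(ρ+2) · Γ(1-ρ)/(1+ρ) · sin(πρ) = πρ. The first factor has norm at
most 2 and the sine at most e^{π Im ρ}, so the middle one cannot be small. The 4 is a crude bound
for π. -/
lemma exp_le_norm_Gamma_div {ρ : ℂ} (h1 : -(1 / 2) ≤ ρ.re) (h2 : ρ.re ≤ 1 / 2) (h3 : 1 ≤ ρ.im) :
    Real.exp (-(4 * ρ.im)) ≤ ‖Complex.Gamma (1 - ρ) / (1 + ρ)‖ := by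
  have hρ0 : ρ ≠ 0 := by rintro rfl; norm_num at h3
  have hρ1 : ρ + 1 ≠ 0 := by
    rw [add_comm]; exact one_add_ne_zero_of_neg_one_lt_re (by linarith)
  have hG2 : Complex.Gamma (ρ + 1 + 1) = (ρ + 1) * (ρ * Complex.Gamma ρ) := by
    rw [Complex.Gamma_add_one _ hρ1, Complex.Gamma_add_one _ hρ0]
  have hle : ‖Complex.Gamma (ρ + 1 + 1)‖ ≤ 2 := by
    have hre : (ρ + 1 + 1).re = ρ.re + 2 := by simp; ring
    refine (norm_Gamma_le (by rw [hre]; linarith)).trans ?_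
    rw [hre]
    -- Re ρ + 2 lies in [1, 3], where convexity bounds Γ by max(Γ(1), Γ(3)) = 2.
    have h := Real.convexOn_Gamma.le_max_of_mem_Icc (x := 1) (y := 3) (z := ρ.re + 2)
      (by simp) (by simp) ⟨by linarith, by linarith⟩
    have h3 : Real.Gamma 3 = 2 := by
      rw [show (3 : ℝ) = ((2 : ℕ) : ℝ) + 1 by norm_num, Real.Gamma_nat_eq_factorial]; norm_num
    rw [Real.Gamma_one, h3] at h
    exact h.trans (by norm_num)
  have hrefl := Complex.Gamma_mul_Gamma_one_sub ρ
  have hsin := norm_sin_le (Real.pi * ρ)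
  have him : ((Real.pi : ℂ) * ρ).im = Real.pi * ρ.im := by simp
  rw [him, abs_of_nonneg (mul_nonneg Real.pi_pos.le (by linarith))] at hsin
  have hsin0 : Complex.sin (Real.pi * ρ) ≠ 0 := by
    intro h
    rw [h, div_zero, mul_eq_zero] at hrefl
    rcases hrefl with h | h
    · refine Complex.Gamma_ne_zero (fun m hm => ?_) h
      rw [hm] at h3; simp at h3; linarith
    · refine Complex.Gamma_ne_zero (fun m hm => ?_) h
      have := congrArg Complex.im hm
      simp at this; linarith
  have key : ‖Complex.Gamma (ρ + 1 + 1)‖ * ‖Complex.Gamma (1 - ρ) / (1 + ρ)‖ *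
      ‖Complex.sin (Real.pi * ρ)‖ = ‖ρ‖ * Real.pi := by
    rw [hG2, ← norm_mul, ← norm_mul, show Complex.Gamma (1 - ρ) / (1 + ρ) =
      Complex.Gamma (1 - ρ) / (ρ + 1) by rw [add_comm]]
    have : (ρ + 1) * (ρ * Complex.Gamma ρ) * (Complex.Gamma (1 - ρ) / (ρ + 1)) *
        Complex.sin (Real.pi * ρ) = ρ * Real.pi := by
      rw [eq_div_iff hsin0] at hrefl
      rw [mul_div_assoc']
      rw [div_mul_eq_mul_div, div_eq_iff hρ1]
      linear_combination ρ * (ρ + 1) * hrefl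
    rw [this, norm_mul, Complex.norm_real, Real.norm_of_nonneg Real.pi_pos.le]
  have hρn : 1 ≤ ‖ρ‖ := h3.trans ((le_abs_self _).trans (Complex.abs_im_le_norm ρ))
  set q := ‖Complex.Gamma (1 - ρ) / (1 + ρ)‖
  have hq : 0 ≤ q := norm_nonneg _
  have hup : Real.pi ≤ 2 * q * Real.exp (Real.pi * ρ.im) := by
    calc Real.pi ≤ ‖ρ‖ * Real.pi := le_mul_of_one_le_left Real.pi_pos.le hρn
      _ = _ := key.symm
      _ ≤ _ := by gcongr
  have hexp : Real.exp (Real.pi * ρ.im) ≤ Real.exp (4 * ρ.im) :=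
    Real.exp_le_exp.2 (mul_le_mul_of_nonneg_right Real.pi_le_four (by linarith))
  have h5 : 1 ≤ q * Real.exp (4 * ρ.im) := by
    have := Real.pi_gt_three
    have := mul_le_mul_of_nonneg_left hexp hq
    linarith
  rw [Real.exp_neg]
  rwa [inv_le_iff_one_le_mul₀ (Real.exp_pos _)]

lemma norm_integral_poissonTail_sub_le {ρ : ℂ} (h1 : -(1 / 2) ≤ ρ.re) (h2 : ρ.re < 1)
    {x : ℝ} (hx : 1 ≤ x) :
    ‖Complex.Gamma (1 - ρ) / (1 + ρ) - ∫ t in (0 : ℝ)..x, (t : ℂ) ^ (-2 - ρ) * poissonTail t‖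
      ≤ 2 * x ^ (-(1 / 2) : ℝ) := by
  have hx0 : 0 < x := by linarith
  have hI := integrableOn_poissonTail (by linarith) h2
  have hIx := hI.mono_set (Set.Ioi_subset_Ioi hx0.le)
  rw [← integral_poissonTail (by linarith) h2,
    ← intervalIntegral.integral_interval_add_Ioi hI hIx, add_sub_cancel_left]
  have hle (t : ℝ) (ht : t ∈ Set.Ioi x) :
      ‖(t : ℂ) ^ (-2 - ρ) * poissonTail t‖ ≤ t ^ (-(3 / 2) : ℝ) := by
    have ht : x < t := ht
    have ht0 : 0 < t := by linarith
    rw [norm_mul, Complex.norm_cpow_eq_rpow_re_of_pos ht0, Complex.norm_real,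
      Real.norm_of_nonneg (poissonTail_nonneg ht0.le)]
    calc _ ≤ t ^ (-(3 / 2) : ℝ) * 1 := by
          gcongr
          · exact poissonTail_nonneg ht0.le
          · linarith
          · simp; linarith
          · exact poissonTail_le_one ht0.le
      _ = _ := mul_one _
  refine (norm_integral_le_of_norm_le (integrableOn_Ioi_rpow_of_lt (by norm_num) hx0)
    ((ae_restrict_iff' measurableSet_Ioi).2 (ae_of_all _ hle))).trans (le_of_eq ?_)
  rw [integral_Ioi_rpow_of_lt (by norm_num) hx0]
  norm_num
  ring

/-! ### The renewal identity -/

lemma ofReal_cpow_neg_two_mul (t y : ℝ) :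
    (t : ℂ) ^ (-2 - 0 : ℂ) * y = ((y / t ^ 2 : ℝ) : ℂ) := by
  rw [sub_zero, Complex.cpow_neg]
  push_cast
  norm_cast
  rw [div_eq_inv_mul]

section Identity

variable {A : Type*} [Fintype A] [Nontrivial A] {p : A → ℝ}

/-- Near 0 the quadratic bound on `meanSize` leaves t^{-Re ρ}, integrable because Re ρ < 1; the
endpoint 0 is therefore allowed. -/
lemma intervalIntegrable_meanSize (hp : ∀ a, 0 < p a) (hs : ∑ a, p a = 1) {ρ : ℂ} (h : ρ.re < 1)
    {x y : ℝ} (hx : 0 ≤ x) (hy : 0 ≤ y) :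
    IntervalIntegrable (fun t : ℝ => (t : ℂ) ^ (-2 - ρ) * meanSize p t) volume x y := by
  have hsub : Set.uIoc x y ⊆ Set.Ioi 0 := fun t ht =>
    lt_of_le_of_lt (le_min hx hy) ht.1
  have hr : IntervalIntegrable
      (fun t : ℝ => (∑' v : List A, stringProb p v ^ 2) * t ^ (-ρ.re)) volume x y :=
    (intervalIntegral.intervalIntegrable_rpow' (by linarith)).const_mul _
  refine hr.mono_fun ?_ ?_
  · refine AEMeasurable.aestronglyMeasurable (AEMeasurable.mul ?_ ?_)
    · exact ((Complex.measurable_ofReal).pow_const _).aemeasurable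
    · exact Complex.measurable_ofReal.comp_aemeasurable
        ((aemeasurable_meanSize hp hs).mono_measure (Measure.restrict_mono hsub le_rfl))
  · refine (ae_restrict_iff' measurableSet_uIoc).2 (ae_of_all _ fun t ht => ?_)
    have ht : 0 < t := hsub ht
    refine le_trans ?_ (le_abs_self _)
    change ‖(t : ℂ) ^ (-2 - ρ) * meanSize p t‖ ≤ _
    rw [norm_mul, Complex.norm_cpow_eq_rpow_re_of_pos ht, Complex.norm_real,
      Real.norm_of_nonneg (meanSize_nonneg hp ht.le)]
    calc _ ≤ t ^ (-2 - ρ).re * ((∑' v : List A, stringProb p v ^ 2) * t ^ 2) := by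
          gcongr; exact meanSize_le_sq hp hs ht.le
      _ = (∑' v : List A, stringProb p v ^ 2) * (t ^ (-2 - ρ).re * t ^ (2 : ℝ)) := by
          rw [Real.rpow_two]; ring
      _ = _ := by
          rw [← Real.rpow_add ht]; congr 2; simp; ring

/-- The substitution t ↦ pₐ t turns pₐ^{1+ρ} times the integral over (0, pₐ x) into the integral of
t^{-2-ρ} M(pₐ t) over (0, x). Since the weights pₐ^{1+ρ} sum to 1, the full integrals of M combine
with these through the renewal equation, leaving only g. -/
lemma sum_integral_meanSize (hp : ∀ a, 0 < p a) (hs : ∑ a, p a = 1) {ρ : ℂ} (h : ρ.re < 1)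
    (hρ : ∑ a, (p a : ℂ) ^ (1 + ρ) = 1) {x : ℝ} (hx : 0 ≤ x) :
    ∑ a, (p a : ℂ) ^ (1 + ρ) * ∫ t in (p a * x)..x, (t : ℂ) ^ (-2 - ρ) * meanSize p t =
      ∫ t in (0 : ℝ)..x, (t : ℂ) ^ (-2 - ρ) * poissonTail t := by
  have hI {x y : ℝ} (hx : 0 ≤ x) (hy : 0 ≤ y) := intervalIntegrable_meanSize hp hs h hx hy
  have hscale (a : A) (t : ℝ) (ht : t ∈ Set.uIoc 0 x) :
      (p a : ℂ) ^ (2 + ρ) * (((p a * t : ℝ) : ℂ) ^ (-2 - ρ) * meanSize p (p a * t)) =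
        (t : ℂ) ^ (-2 - ρ) * meanSize p (p a * t) := by
    have hpa : (p a : ℂ) ≠ 0 := Complex.ofReal_ne_zero.2 (hp a).ne'
    rw [Set.uIoc_of_le hx] at ht
    rw [Complex.ofReal_mul, Complex.mul_cpow_ofReal_nonneg (hp a).le ht.1.le,
      ← mul_assoc, ← mul_assoc, ← Complex.cpow_add _ _ hpa]
    simp
  have hterm (a : A) : (p a : ℂ) ^ (1 + ρ) *
      ∫ t in (0 : ℝ)..(p a * x), (t : ℂ) ^ (-2 - ρ) * meanSize p t =
      ∫ t in (0 : ℝ)..x, (t : ℂ) ^ (-2 - ρ) * meanSize p (p a * t) := by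
    have hpa : (p a : ℂ) ≠ 0 := Complex.ofReal_ne_zero.2 (hp a).ne'
    have h1 := intervalIntegral.integral_comp_mul_left (a := 0) (b := x)
      (fun t : ℝ => (t : ℂ) ^ (-2 - ρ) * meanSize p t) (hp a).ne'
    have h2 : ∫ t in (0 : ℝ)..x, (t : ℂ) ^ (-2 - ρ) * meanSize p (p a * t) =
        (p a : ℂ) ^ (2 + ρ) *
          ∫ t in (0 : ℝ)..x, ((p a * t : ℝ) : ℂ) ^ (-2 - ρ) * meanSize p (p a * t) := by
      rw [← intervalIntegral.integral_const_mul]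
      exact intervalIntegral.integral_congr_ae (ae_of_all _ fun t ht => (hscale a t ht).symm)
    have h3 : (p a : ℂ) ^ (2 + ρ) = (p a : ℂ) ^ (1 + ρ) * p a := by
      rw [show 2 + ρ = 1 + ρ + 1 by ring, Complex.cpow_add _ _ hpa, Complex.cpow_one]
    rw [h2, h1, mul_zero, Complex.real_smul, h3, Complex.ofReal_inv, mul_assoc,
      mul_inv_cancel_left₀ hpa]
  have hIa (a : A) : IntervalIntegrable
      (fun t : ℝ => (t : ℂ) ^ (-2 - ρ) * meanSize p (p a * t)) volume 0 x := by
    have h1 := (hI le_rfl (mul_nonneg (hp a).le hx)).comp_mul_left (c := p a)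
    rw [zero_div, mul_div_cancel_left₀ _ (hp a).ne'] at h1
    exact (h1.const_mul ((p a : ℂ) ^ (2 + ρ))).congr (fun t ht => hscale a t ht)
  have hsplit (a : A) : ∫ t in (p a * x)..x, (t : ℂ) ^ (-2 - ρ) * meanSize p t =
      (∫ t in (0 : ℝ)..x, (t : ℂ) ^ (-2 - ρ) * meanSize p t) -
        ∫ t in (0 : ℝ)..(p a * x), (t : ℂ) ^ (-2 - ρ) * meanSize p t :=
    (intervalIntegral.integral_interval_sub_left (hI le_rfl hx)
      (hI le_rfl (mul_nonneg (hp a).le hx))).symm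
  have hsumI : IntervalIntegrable
      (fun t : ℝ => ∑ a, (t : ℂ) ^ (-2 - ρ) * meanSize p (p a * t)) volume 0 x := by
    simpa only [Finset.sum_fn] using! IntervalIntegrable.sum Finset.univ fun a _ => hIa a
  simp_rw [hsplit, mul_sub, Finset.sum_sub_distrib, hterm, ← Finset.sum_mul, hρ, one_mul]
  rw [← intervalIntegral.integral_finsetSum fun a _ => hIa a,
    ← intervalIntegral.integral_sub (hI le_rfl hx) hsumI]
  refine intervalIntegral.integral_congr_ae (ae_of_all _ fun t ht => ?_)
  rw [Set.uIoc_of_le hx] at ht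
  rw [← Finset.mul_sum, ← mul_sub, meanSize_eq hp hs ht.1.le]
  push_cast
  ring

lemma sum_integral_meanSize_div_sq (hp : ∀ a, 0 < p a) (hs : ∑ a, p a = 1) {x : ℝ} (hx : 0 ≤ x) :
    ∑ a, p a * ∫ t in (p a * x)..x, meanSize p t / t ^ 2 =
      ∫ t in (0 : ℝ)..x, poissonTail t / t ^ 2 := by
  have h := sum_integral_meanSize hp hs (ρ := 0) (by simp)
    (by simp only [add_zero, Complex.cpow_one]; exact_mod_cast hs) hx
  simp_rw [ofReal_cpow_neg_two_mul, intervalIntegral.integral_ofReal, add_zero, Complex.cpow_one] at h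
  exact_mod_cast h

lemma tendsto_integral_poissonTail_div_sq :
    Tendsto (fun x => ∫ t in (0 : ℝ)..x, poissonTail t / t ^ 2) atTop (𝓝 1) := by
  have h1 := integrableOn_poissonTail (ρ := 0) (by simp) (by simp)
  have h2 := integral_poissonTail (ρ := 0) (by simp) (by simp)
  have h := intervalIntegral_tendsto_integral_Ioi 0 h1 tendsto_id
  rw [h2] at h
  simp_rw [ofReal_cpow_neg_two_mul, intervalIntegral.integral_ofReal] at h
  have h' := (Complex.continuous_re.tendsto _).comp h
  simpa [Function.comp_def] using h'

lemma integral_poissonTail_div_sq_le_one {x : ℝ} (hx : 0 ≤ x) :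
    ∫ t in (0 : ℝ)..x, poissonTail t / t ^ 2 ≤ 1 := by
  have hI : IntegrableOn (fun t : ℝ => poissonTail t / t ^ 2) (Set.Ioi 0) := by
    have h1 := integrableOn_poissonTail (ρ := 0) (by simp) (by simp)
    simp_rw [ofReal_cpow_neg_two_mul] at h1
    exact h1.re
  have hII (x : ℝ) (hx : 0 ≤ x) : IntervalIntegrable (fun t : ℝ => poissonTail t / t ^ 2) volume 0 x :=
    (intervalIntegrable_iff_integrableOn_Ioc_of_le hx).2 (hI.mono_set Set.Ioc_subset_Ioi_self)
  refine ge_of_tendsto tendsto_integral_poissonTail_div_sq ?_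
  filter_upwards [eventually_ge_atTop x] with y hy
  refine intervalIntegral.integral_mono_interval le_rfl hx hy ?_ (hII y (hx.trans hy))
  refine (ae_restrict_iff' measurableSet_Ioc).2 (ae_of_all _ fun t ht => ?_)
  exact div_nonneg (poissonTail_nonneg ht.1.le) (sq_nonneg t)

/-- At ρ = 0 each term of the identity is nonnegative and the total is at most 1. A single letter
suffices: on its window M stays above pₐ² M(x), so pₐ³(1 - pₐ) M(x)/x ≤ 1. -/
lemma exists_meanSize_le_mul (hp : ∀ a, 0 < p a) (hs : ∑ a, p a = 1) :
    ∃ B, ∀ t, 0 < t → meanSize p t ≤ B * t := by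
  obtain ⟨a⟩ := (inferInstance : Nonempty A)
  have hpa := hp a
  have hpa1 := lt_one_of_sum_eq_one hp hs a
  refine ⟨(p a ^ 3 * (1 - p a))⁻¹, fun x hx => ?_⟩
  have hI (b : A) : IntervalIntegrable (fun t => meanSize p t / t ^ 2) volume (p b * x) x := by
    have h1 := (intervalIntegrable_meanSize hp hs (ρ := 0) (by simp) (mul_pos (hp b) hx).le hx.le)
    simp_rw [ofReal_cpow_neg_two_mul] at h1
    exact intervalIntegrable_iff.2 (intervalIntegrable_iff.1 h1).re
  have hlex (b : A) : p b * x ≤ x := mul_le_of_le_one_left hx.le (lt_one_of_sum_eq_one hp hs b).le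
  have hle : p a * ∫ t in (p a * x)..x, meanSize p t / t ^ 2 ≤ 1 := by
    refine le_trans ?_ (integral_poissonTail_div_sq_le_one hx.le)
    rw [← sum_integral_meanSize_div_sq hp hs hx.le]
    refine Finset.single_le_sum (f := fun a => p a * ∫ t in (p a * x)..x, meanSize p t / t ^ 2)
      (fun b _ => mul_nonneg (hp b).le (intervalIntegral.integral_nonneg (hlex b) fun t ht => ?_))
      (Finset.mem_univ a)
    exact div_nonneg (meanSize_nonneg hp ((mul_pos (hp b) hx).le.trans ht.1)) (sq_nonneg t)
  have hlow : (p a ^ 2 * meanSize p x / x ^ 2) * (x - p a * x) ≤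
      ∫ t in (p a * x)..x, meanSize p t / t ^ 2 := by
    have : ∫ _ in (p a * x)..x, p a ^ 2 * meanSize p x / x ^ 2 =
        (p a ^ 2 * meanSize p x / x ^ 2) * (x - p a * x) := by
      rw [intervalIntegral.integral_const, smul_eq_mul, mul_comm]
    rw [← this]
    refine intervalIntegral.integral_mono_on (hlex a) (by simp) (hI a) fun t ht => ?_
    have ht0 : 0 < t := (mul_pos hpa hx).trans_le ht.1
    have h1 : meanSize p x ≤ (p a)⁻¹ ^ 2 * meanSize p (p a * x) := by
      have := meanSize_mul_le hp hs ((one_le_inv₀ hpa).2 hpa1.le) (mul_pos hpa hx).le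
      rwa [inv_mul_cancel_left₀ hpa.ne'] at this
    have h2 : meanSize p (p a * x) ≤ meanSize p t :=
      meanSize_monotoneOn hp hs (mul_pos hpa hx).le ht0.le ht.1
    have h3 : p a ^ 2 * meanSize p x ≤ meanSize p t := by
      refine le_trans ?_ h2
      rw [inv_pow, ← div_eq_inv_mul, le_div_iff₀ (by positivity)] at h1
      linarith
    have := meanSize_nonneg hp ht0.le
    gcongr
    exact ht.2
  have h1p : 0 < 1 - p a := by linarith
  have h2 := (mul_le_mul_of_nonneg_left hlow hpa.le).trans hle
  have h3 : p a * (p a ^ 2 * meanSize p x / x ^ 2 * (x - p a * x)) =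
      p a ^ 3 * (1 - p a) * meanSize p x / x := by field_simp
  rw [h3, div_le_one hx] at h2
  rwa [← div_eq_inv_mul, le_div_iff₀ (by positivity), mul_comm]

end Identity

/-! ### A renewal theorem for finitely supported step distributions -/

section Renewal

variable {A : Type*}

lemma exists_sub_of_mem_addSubgroup_closure {S : Set ℝ} {x : ℝ} (hx : x ∈ AddSubgroup.closure S) :
    ∃ s ∈ AddSubmonoid.closure S, ∃ s' ∈ AddSubmonoid.closure S, x = s - s' := by
  induction hx using AddSubgroup.closure_induction with
  | mem x hx => exact ⟨x, AddSubmonoid.subset_closure hx, 0, zero_mem _, by simp⟩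
  | zero => exact ⟨0, zero_mem _, 0, zero_mem _, by simp⟩
  | add x y _ _ ihx ihy =>
    obtain ⟨s, hs, s', hs', rfl⟩ := ihx
    obtain ⟨r, hr, r', hr', rfl⟩ := ihy
    exact ⟨s + r, add_mem hs hr, s' + r', add_mem hs' hr', by ring⟩
  | neg x _ ihx =>
    obtain ⟨s, hs, s', hs', rfl⟩ := ihx
    exact ⟨s', hs', s, hs, by ring⟩

/-- A submonoid of the positive reals that generates a dense group is eventually dense. -/
lemma exists_forall_mem_addSubmonoid_closure {S : Set ℝ} (hS : ∀ x ∈ S, 0 < x) (hne : S.Nonempty)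
    (hd : Dense (AddSubgroup.closure S : Set ℝ)) {ε : ℝ} (hε : 0 < ε) :
    ∃ L : ℝ, ∀ x, L ≤ x → ∃ s ∈ AddSubmonoid.closure S, |x - s| < ε := by
  obtain ⟨g, hgS, hg0, hgε⟩ := hd.exists_between hε
  obtain ⟨s, hs, s', hs', rfl⟩ := exists_sub_of_mem_addSubgroup_closure hgS
  obtain ⟨l, hl⟩ := hne
  have hl0 := hS l hl
  have hpos : ∀ x ∈ AddSubmonoid.closure S, 0 ≤ x := by
    intro x hx
    induction hx using AddSubmonoid.closure_induction with
    | mem x hx => exact (hS x hx).le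
    | zero => exact le_rfl
    | add x y _ _ hx hy => exact add_nonneg hx hy
  have hlM := AddSubmonoid.subset_closure hl
  -- Adding the generator `l` makes `r` positive even if `s' = 0`. Both `r` and `r + g` lie in the
  -- monoid although `g` itself need not.
  set r := s' + l with hr
  set g := s - s' with hg
  have hr0 : 0 < r := by have := hpos s' hs'; linarith
  have hrM : r ∈ AddSubmonoid.closure S := add_mem hs' hlM
  have hrgM : r + g ∈ AddSubmonoid.closure S := by
    have : r + g = s + l := by rw [hr, hg]; ring
    rw [this]; exact add_mem hs hlM
  refine ⟨r * (r / g + 1), fun x hx => ?_⟩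
  have hx0 : 0 ≤ x := le_trans (by positivity) hx
  set n := ⌊x / r⌋₊ with hn
  have hn1 : n * r ≤ x := by
    rw [← le_div_iff₀ hr0]; exact Nat.floor_le (by positivity)
  have hn2 : x < (n + 1) * r := by
    rw [← div_lt_iff₀ hr0]; exact Nat.lt_floor_add_one _
  have hn3 : r / g ≤ n := by
    have h1 : (r / g + 1) ≤ x / r := by rw [le_div_iff₀ hr0]; linarith
    have h2 : x / r < n + 1 := Nat.lt_floor_add_one _
    linarith
  set j := ⌊(x - n * r) / g⌋₊ with hj
  have hj1 : j * g ≤ x - n * r := by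
    rw [← le_div_iff₀ hg0]; exact Nat.floor_le (div_nonneg (by linarith) hg0.le)
  have hj2 : x - n * r < (j + 1) * g := by
    rw [← div_lt_iff₀ hg0]; exact Nat.lt_floor_add_one _
  have hjn : j ≤ n := by
    have h1 : (j : ℝ) * g ≤ r := by linarith
    rw [← le_div_iff₀ hg0] at h1
    exact_mod_cast h1.trans hn3
  -- This element is nr + jg. Once n ≥ r/g, all j up to r/g are available, so these points cover
  -- [nr, (n+1)r] with spacing g < ε.
  refine ⟨(n - j) • r + j • (r + g), add_mem (nsmul_mem hrM _) (nsmul_mem hrgM _), ?_⟩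
  rw [nsmul_eq_mul, nsmul_eq_mul, Nat.cast_sub hjn, abs_lt]
  constructor <;> nlinarith

lemma realGcd_ne_zero [Nonempty A] {l : A → ℝ} (hl : ∀ a, 0 < l a) {d : ℝ} (hd : 0 < d)
    (h : ∀ a, ∃ k : ℤ, l a = k * d) : realGcd (Set.range l) ≠ 0 := by
  obtain ⟨a⟩ := (inferInstance : Nonempty A)
  suffices hle : d ≤ realGcd (Set.range l) from (hd.trans_le hle).ne'
  unfold realGcd
  -- Boundedness matters, since the real supremum of an unbounded set is 0 by convention; a positive
  -- multiple of `e` is at least `e`, so `l a` is a bound.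
  refine le_csSup ⟨l a, ?_⟩ ⟨hd, ?_⟩
  · rintro e ⟨he, hle⟩
    obtain ⟨k, hk⟩ := hle (l a) ⟨a, rfl⟩
    have hk0 : 0 < (k : ℝ) := by
      by_contra! hk'
      have := hl a
      nlinarith
    have hk1 : (1 : ℝ) ≤ k := by exact_mod_cast hk0
    nlinarith
  · rintro _ ⟨a, rfl⟩
    exact h a

/-- If the greatest common divisor of positive numbers is zero, they generate a dense group. -/
lemma dense_of_realGcd_eq_zero [Nonempty A] {l : A → ℝ} (hl : ∀ a, 0 < l a)
    (h : realGcd (Set.range l) = 0) : Dense (AddSubgroup.closure (Set.range l) : Set ℝ) := by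
  refine (AddSubgroup.dense_or_cyclic _).resolve_right ?_
  rintro ⟨d, hd⟩
  have hmem (a : A) : ∃ k : ℤ, l a = k * |d| := by
    have : l a ∈ AddSubgroup.closure {d} := hd ▸ AddSubgroup.subset_closure ⟨a, rfl⟩
    obtain ⟨k, hk⟩ := AddSubgroup.mem_closure_singleton.1 this
    rw [zsmul_eq_mul] at hk
    rcases abs_choice d with h | h
    · exact ⟨k, by rw [h, hk]⟩
    · exact ⟨-k, by rw [h, ← hk]; push_cast; ring⟩
  obtain ⟨a⟩ := (inferInstance : Nonempty A)
  have hd0 : 0 < |d| := by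
    refine abs_pos.2 fun h0 => ?_
    obtain ⟨k, hk⟩ := hmem a
    have := hl a
    simp [h0] at hk
    linarith
  exact absurd h (realGcd_ne_zero hl hd0 hmem)

variable [Fintype A]

/-- A maximum principle at infinity: β is an average of the limits of the shifted values, none of
which exceeds β, so each equals β. Iterating reaches every shift in the monoid. The ultrafilter
makes all these limits exist without passing to subsequences. -/
lemma tendsto_comp_sub_of_ultrafilter {p l : A → ℝ} (hp : ∀ a, 0 < p a) (hs : ∑ a, p a = 1)
    {f k : ℝ → ℝ} {B β : ℝ} (hB : ∀ u, |f u| ≤ B) (hk : Tendsto k atTop (𝓝 0))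
    (hf : ∀ u, f u = k u + ∑ a, p a * f (u - l a)) (hβ : ∀ c, β < c → ∀ᶠ u in atTop, f u < c)
    {U : Ultrafilter ℝ} (hU : (U : Filter ℝ) ≤ atTop) (hfU : Tendsto f U (𝓝 β)) {s : ℝ}
    (hsl : s ∈ AddSubmonoid.closure (Set.range l)) :
    Tendsto (fun u => f (u - s)) U (𝓝 β) := by
  have hshift (s : ℝ) : Tendsto (fun u => u - s) U atTop :=
    (tendsto_atTop_add_const_right atTop (-s) tendsto_id).mono_left hU
  have step (s : ℝ) (ih : Tendsto (fun u => f (u - s)) U (𝓝 β)) (a : A) :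
      Tendsto (fun u => f (u - s - l a)) U (𝓝 β) := by
    have hlim (a : A) : ∃ x ≤ β, Tendsto (fun u => f (u - s - l a)) U (𝓝 x) := by
      have hc : IsCompact (Set.Icc (-B) B) := isCompact_Icc
      obtain ⟨x, -, hx⟩ := hc.ultrafilter_le_nhds (U.map fun u => f (u - s - l a)) (by
        rw [le_principal_iff, Ultrafilter.coe_map, mem_map]
        exact univ_mem' fun u => abs_le.1 (hB _))
      refine ⟨x, le_of_forall_gt fun c hc => ?_, hx⟩
      obtain ⟨c', h1, h2⟩ := exists_between hc
      refine lt_of_le_of_lt (le_of_tendsto hx ?_) h2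
      have := ((hshift s).eventually ((tendsto_atTop_add_const_right atTop (-l a)
        tendsto_id).eventually (hβ c' h1)))
      exact this.mono fun u hu => hu.le
    choose x hxβ hx using hlim
    have h1 : Tendsto (fun u => k (u - s) + ∑ a, p a * f (u - s - l a)) U
        (𝓝 (0 + ∑ a, p a * x a)) :=
      (hk.comp (hshift s)).add (tendsto_finsetSum _ fun a _ => (hx a).const_mul (p a))
    simp_rw [← hf] at h1
    have h2 := tendsto_nhds_unique ih h1
    have h3 : ∑ a, p a * (β - x a) = 0 := by
      simp_rw [mul_sub, Finset.sum_sub_distrib, ← Finset.sum_mul, hs]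
      linarith
    have h4 := (Finset.sum_eq_zero_iff_of_nonneg fun b _ =>
      mul_nonneg (hp b).le (sub_nonneg.2 (hxβ b))).1 h3 a (Finset.mem_univ a)
    have h5 : x a = β := by
      rcases mul_eq_zero.1 h4 with h | h
      · exact absurd h (hp a).ne'
      · linarith
    exact h5 ▸ hx a
  induction hsl using AddSubmonoid.closure_induction_right with
  | zero => simpa using hfU
  | add_right s _ y hy ih =>
    obtain ⟨a, rfl⟩ := hy
    simpa only [sub_sub] using step s ih a

/-- Let β be the limsup of f, attained along an ultrafilter. Shifts in the eventually dense monoid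
keep f near β, so by uniform continuity f is nearly β or more on a whole window. Integrating over
steps gives β ∑ pₐ lₐ ≤ κ. -/
lemma eventually_lt_of_renewal [Nonempty A] {p l : A → ℝ} (hp : ∀ a, 0 < p a) (hs : ∑ a, p a = 1)
    (hl : ∀ a, 0 < l a) (hd : Dense (AddSubgroup.closure (Set.range l) : Set ℝ))
    {f k : ℝ → ℝ} {B κ : ℝ} (hB : ∀ u, |f u| ≤ B) (hfc : UniformContinuous f)
    (hk : Tendsto k atTop (𝓝 0)) (hf : ∀ u, f u = k u + ∑ a, p a * f (u - l a))
    (hκ : Tendsto (fun u => ∑ a, p a * ∫ s in (u - l a)..u, f s) atTop (𝓝 κ))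
    {c : ℝ} (hc : κ / ∑ a, p a * l a < c) : ∀ᶠ u in atTop, f u < c := by
  set h := ∑ a, p a * l a with hh
  have hpos : 0 < h := Finset.sum_pos (fun a _ => mul_pos (hp a) (hl a)) Finset.univ_nonempty
  have hbdd : IsBoundedUnder (· ≤ ·) atTop f :=
    isBoundedUnder_of ⟨B, fun u => (abs_le.1 (hB u)).2⟩
  have hcobdd : IsCoboundedUnder (· ≤ ·) atTop f :=
    (isBoundedUnder_of ⟨-B, fun u => (abs_le.1 (hB u)).1⟩ :
      IsBoundedUnder (· ≥ ·) atTop f).isCoboundedUnder_le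
  set β := limsup f atTop with hβ
  have hβlt (c : ℝ) (hc : β < c) : ∀ᶠ u in atTop, f u < c := eventually_lt_of_limsup_lt hc hbdd
  refine hβlt c (lt_of_le_of_lt ?_ hc)
  rw [le_div_iff₀ hpos]
  have hcl : MapClusterPt β atTop f := by
    rw [mapClusterPt_iff_frequently]
    intro s hs
    obtain ⟨ε, hε, hsub⟩ := Metric.mem_nhds_iff.1 hs
    have h1 : ∃ᶠ u in atTop, β - ε < f u := frequently_lt_of_lt_limsup hcobdd (by linarith)
    refine (h1.and_eventually (hβlt (β + ε) (by linarith))).mono fun u hu => hsub ?_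
    rw [Metric.mem_ball, Real.dist_eq, abs_lt]
    constructor <;> linarith [hu.1, hu.2]
  obtain ⟨U, hU, hfU⟩ := mapClusterPt_iff_ultrafilter.1 hcl
  have key (ε : ℝ) (hε : 0 < ε) : (β - 2 * ε) * h ≤ κ + ε := by
    obtain ⟨δ, hδ, hfδ⟩ := Metric.uniformContinuous_iff.1 hfc ε hε
    obtain ⟨L, hL⟩ := exists_forall_mem_addSubmonoid_closure (by rintro _ ⟨a, rfl⟩; exact hl a)
      (Set.range_nonempty l) hd (half_pos hδ)
    obtain ⟨M, hM⟩ : ∃ M, ∀ a, l a ≤ M := (Finite.bddAbove_range l).imp fun M hM a => hM ⟨a, rfl⟩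
    -- A finite net is needed because convergence along the ultrafilter is uniform only over
    -- finitely many shifts.
    obtain ⟨t, htsub, htfin, htcov⟩ := Metric.finite_approx_of_totallyBounded
      (isCompact_Icc (a := L) (b := L + M)).totallyBounded (δ / 2) (half_pos hδ)
    have hnet : ∀ y ∈ t, ∃ s ∈ AddSubmonoid.closure (Set.range l), |y - s| < δ / 2 :=
      fun y hy => hL y (htsub hy).1
    choose! s hsl hsy using hnet
    have hev : ∀ᶠ u in (U : Filter ℝ), ∀ y ∈ t, β - ε < f (u - s y) := by
      rw [eventually_all_finite htfin]
      intro y hy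
      exact (tendsto_comp_sub_of_ultrafilter hp hs hB hk hf hβlt hU hfU (hsl y hy)).eventually
        (lt_mem_nhds (by linarith))
    have hevK : ∀ᶠ u in (U : Filter ℝ), ∑ a, p a * ∫ s in (u - L - l a)..(u - L), f s < κ + ε :=
      ((hκ.comp (tendsto_atTop_add_const_right atTop (-L) tendsto_id)).mono_left hU).eventually
        (gt_mem_nhds (by linarith))
    obtain ⟨u, hu1, hu2⟩ := (hev.and hevK).exists
    have hlow (x : ℝ) (hx : x ∈ Set.Icc L (L + M)) : β - 2 * ε ≤ f (u - x) := by
      obtain ⟨y, hy, hxy⟩ := Set.mem_iUnion₂.1 (htcov hx)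
      have h1 : dist (u - x) (u - s y) < δ := by
        rw [Metric.mem_ball, Real.dist_eq] at hxy
        rw [Real.dist_eq, show u - x - (u - s y) = -((x - y) + (y - s y)) by ring, abs_neg]
        exact (abs_add_le _ _).trans_lt (by linarith [hsy y hy])
      have h2 := hfδ h1
      rw [Real.dist_eq, abs_lt] at h2
      linarith [hu1 y hy, h2.1]
    refine le_trans ?_ hu2.le
    rw [hh, Finset.mul_sum]
    refine Finset.sum_le_sum fun a _ => ?_
    rw [mul_left_comm]
    refine mul_le_mul_of_nonneg_left ?_ (hp a).le
    have hconst : ∫ _ in (u - L - l a)..(u - L), (β - 2 * ε) = (β - 2 * ε) * l a := by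
      rw [intervalIntegral.integral_const, smul_eq_mul]; ring
    rw [← hconst]
    refine intervalIntegral.integral_mono_on (by linarith [hl a]) (by simp)
      (hfc.continuous.intervalIntegrable _ _) fun x hx => ?_
    have := hlow (u - x) ⟨by linarith [hx.2], by linarith [hx.1, hM a]⟩
    rwa [sub_sub_cancel] at this
  refine le_of_forall_pos_le_add fun ε hε => ?_
  have := key (ε / (1 + 2 * h)) (by positivity)
  have e : ε / (1 + 2 * h) + 2 * (ε / (1 + 2 * h)) * h = ε := by field_simp
  linarith

/-- The solution of a renewal equation whose step distribution has finite non-lattice support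
converges, and its limit is determined by the integrals over one step. -/
lemma tendsto_of_renewal [Nonempty A] {p l : A → ℝ} (hp : ∀ a, 0 < p a) (hs : ∑ a, p a = 1)
    (hl : ∀ a, 0 < l a) (hd : Dense (AddSubgroup.closure (Set.range l) : Set ℝ))
    {f k : ℝ → ℝ} {B κ : ℝ} (hB : ∀ u, |f u| ≤ B) (hfc : UniformContinuous f)
    (hk : Tendsto k atTop (𝓝 0)) (hf : ∀ u, f u = k u + ∑ a, p a * f (u - l a))
    (hκ : Tendsto (fun u => ∑ a, p a * ∫ s in (u - l a)..u, f s) atTop (𝓝 κ)) :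
    Tendsto f atTop (𝓝 (κ / ∑ a, p a * l a)) := by
  refine tendsto_order.2 ⟨fun c hc => ?_, fun c hc =>
    eventually_lt_of_renewal hp hs hl hd hB hfc hk hf hκ hc⟩
  have h := eventually_lt_of_renewal hp hs hl hd (f := fun u => -f u) (k := fun u => -k u)
    (κ := -κ) (c := -c) (by simpa using hB) hfc.neg (by simpa using hk.neg)
    (fun u => by simp only [mul_neg, Finset.sum_neg_distrib]; rw [hf u]; ring)
    (by simpa only [intervalIntegral.integral_neg, mul_neg, Finset.sum_neg_distrib] using hκ.neg)
    (by rw [neg_div]; linarith)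
  exact h.mono fun u hu => by linarith

end Renewal

/-! ### The limit of the normalized mean size -/

section Limit

lemma entropy_eq_sum {A : Type*} [Fintype A] (p : A → ℝ) : entropy p = ∑ a, p a * -Real.log (p a) := by
  simp [entropy, Finset.sum_neg_distrib]

lemma exp_sub_neg_log {A : Type*} {p : A → ℝ} (hp : ∀ a, 0 < p a) (a : A) (u : ℝ) :
    Real.exp (u - -Real.log (p a)) = p a * Real.exp u := by
  rw [sub_neg_eq_add, Real.exp_add, Real.exp_log (hp a), mul_comm]

variable {A : Type*} [Fintype A] [Nontrivial A] {p : A → ℝ}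

lemma neg_log_pos (hp : ∀ a, 0 < p a) (hs : ∑ a, p a = 1) (a : A) : 0 < -Real.log (p a) :=
  neg_pos.2 (Real.log_neg (hp a) (lt_one_of_sum_eq_one hp hs a))

lemma exists_abs_meanSize_exp_div_le (hp : ∀ a, 0 < p a) (hs : ∑ a, p a = 1) :
    ∃ B, ∀ u, |meanSize p (Real.exp u) / Real.exp u| ≤ B := by
  obtain ⟨B, hB⟩ := exists_meanSize_le_mul hp hs
  refine ⟨B, fun u => ?_⟩
  rw [abs_of_nonneg (div_nonneg (meanSize_nonneg hp (Real.exp_pos u).le) (Real.exp_pos u).le),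
    div_le_iff₀ (Real.exp_pos u)]
  exact hB _ (Real.exp_pos u)

/-- Monotonicity of M and M(ct) ≤ c²M(t) say that moving u by d changes the quotient by a factor
between e^{-d} and e^d; boundedness makes this a uniform modulus. -/
lemma uniformContinuous_meanSize_exp_div (hp : ∀ a, 0 < p a) (hs : ∑ a, p a = 1) :
    UniformContinuous fun u => meanSize p (Real.exp u) / Real.exp u := by
  obtain ⟨B, hB⟩ := exists_abs_meanSize_exp_div_le hp hs
  set f : ℝ → ℝ := fun u => meanSize p (Real.exp u) / Real.exp u with hf
  have hf0 (u : ℝ) : 0 ≤ f u :=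
    div_nonneg (meanSize_nonneg hp (Real.exp_pos u).le) (Real.exp_pos u).le
  have hfB (u : ℝ) : f u ≤ B := (le_abs_self _).trans (hB u)
  have hB0 : 0 ≤ B := (hf0 0).trans (hfB 0)
  have key (u d : ℝ) (hd : 0 ≤ d) : |f (u + d) - f u| ≤ B * (Real.exp d - 1) := by
    have h1 : 1 ≤ Real.exp d := Real.one_le_exp hd
    have hu := Real.exp_pos u
    have hup : f (u + d) ≤ Real.exp d * f u := by
      have := meanSize_mul_le hp hs h1 hu.le
      simp only [hf, Real.exp_add]
      rw [mul_comm (Real.exp u), div_le_iff₀ (by positivity)]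
      refine this.trans (le_of_eq ?_)
      field_simp
    have hlow : f u ≤ Real.exp d * f (u + d) := by
      have : meanSize p (Real.exp u) ≤ meanSize p (Real.exp d * Real.exp u) :=
        meanSize_monotoneOn hp hs hu.le (by positivity : (0 : ℝ) ≤ Real.exp d * Real.exp u)
          (le_mul_of_one_le_left hu.le h1)
      simp only [hf, Real.exp_add]
      rw [mul_comm (Real.exp u) (Real.exp d), div_le_iff₀ hu]
      refine this.trans (le_of_eq ?_)
      field_simp
    have := hfB u
    have := hfB (u + d)
    rw [abs_le]
    constructor <;> nlinarith
  rw [Metric.uniformContinuous_iff]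
  intro ε hε
  have hcont : Tendsto (fun d => B * (Real.exp d - 1)) (𝓝 0) (𝓝 (B * (Real.exp 0 - 1))) :=
    Continuous.tendsto (by fun_prop) 0
  rw [Real.exp_zero, sub_self, mul_zero] at hcont
  obtain ⟨δ, hδ, hball⟩ := Metric.eventually_nhds_iff.1 (hcont.eventually (gt_mem_nhds hε))
  have hle {u v : ℝ} (huv : u ≤ v) (hd : dist u v < δ) : dist (f u) (f v) < ε := by
    have h1 := key u (v - u) (by linarith)
    rw [add_sub_cancel] at h1
    rw [dist_comm, Real.dist_eq]
    refine h1.trans_lt (hball ?_)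
    rw [dist_comm, Real.dist_eq] at hd
    rwa [Real.dist_eq, sub_zero]
  refine ⟨δ, hδ, fun {u v} hd => ?_⟩
  rcases le_total u v with h | h
  · exact hle h hd
  · rw [dist_comm]; rw [dist_comm] at hd; exact hle h hd

lemma meanSize_exp_div_eq (hp : ∀ a, 0 < p a) (hs : ∑ a, p a = 1) (u : ℝ) :
    meanSize p (Real.exp u) / Real.exp u = poissonTail (Real.exp u) / Real.exp u +
      ∑ a, p a * (meanSize p (Real.exp (u - -Real.log (p a))) /
        Real.exp (u - -Real.log (p a))) := by
  rw [meanSize_eq hp hs (Real.exp_pos u).le, add_div, Finset.sum_div]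
  congr 1
  refine Finset.sum_congr rfl fun a _ => ?_
  rw [exp_sub_neg_log hp]
  have := (hp a).ne'
  field_simp

lemma integral_meanSize_exp_div (hp : ∀ a, 0 < p a) (hs : ∑ a, p a = 1) (u v : ℝ) :
    ∫ s in u..v, meanSize p (Real.exp s) / Real.exp s =
      ∫ t in (Real.exp u)..(Real.exp v), meanSize p t / t ^ 2 := by
  have hpos (t : ℝ) (ht : t ∈ Set.uIcc (Real.exp u) (Real.exp v)) : 0 < t :=
    (lt_min (Real.exp_pos u) (Real.exp_pos v)).trans_le ht.1
  have h := intervalIntegral.integral_comp_mul_deriv (a := Real.exp u) (b := Real.exp v)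
    (f := Real.log) (f' := fun t => t⁻¹) (g := fun s => meanSize p (Real.exp s) / Real.exp s)
    (fun t ht => Real.hasDerivAt_log (hpos t ht).ne')
    (continuousOn_inv₀.mono fun t ht => (hpos t ht).ne')
    (uniformContinuous_meanSize_exp_div hp hs).continuous
  rw [Real.log_exp, Real.log_exp] at h
  rw [← h]
  refine intervalIntegral.integral_congr fun t ht => ?_
  simp only [Function.comp_apply]
  rw [Real.exp_log (hpos t ht)]
  field_simp

/-- In the variable u = ln t the steps are -ln pₐ, with mean H, and the window integrals tend to ∫
g(t) t^{-2} dt = 1. -/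
theorem tendsto_meanSize_div (hp : ∀ a, 0 < p a) (hs : ∑ a, p a = 1) (h : period p = 0) :
    Tendsto (fun t => meanSize p t / t) atTop (𝓝 (entropy p)⁻¹) := by
  obtain ⟨B, hB⟩ := exists_abs_meanSize_exp_div_le hp hs
  have hl := neg_log_pos hp hs
  have hk : Tendsto (fun u => poissonTail (Real.exp u) / Real.exp u) atTop (𝓝 0) := by
    refine squeeze_zero (fun u => div_nonneg (poissonTail_nonneg (Real.exp_pos u).le)
      (Real.exp_pos u).le) (fun u => ?_) (Real.tendsto_exp_neg_atTop_nhds_zero)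
    rw [Real.exp_neg, ← one_div]
    exact div_le_div_of_nonneg_right (poissonTail_le_one (Real.exp_pos u).le) (Real.exp_pos u).le
  have hκ : Tendsto (fun u => ∑ a, p a * ∫ s in (u - -Real.log (p a))..u,
      meanSize p (Real.exp s) / Real.exp s) atTop (𝓝 1) := by
    have h1 := tendsto_integral_poissonTail_div_sq.comp Real.tendsto_exp_atTop
    refine h1.congr fun u => ?_
    simp only [Function.comp_apply, integral_meanSize_exp_div hp hs, exp_sub_neg_log hp]
    exact (sum_integral_meanSize_div_sq hp hs (Real.exp_pos u).le).symm
  have hlim := tendsto_of_renewal hp hs hl (dense_of_realGcd_eq_zero hl h) hB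
    (uniformContinuous_meanSize_exp_div hp hs) hk (meanSize_exp_div_eq hp hs) hκ
  rw [← entropy_eq_sum, one_div] at hlim
  refine (hlim.comp Real.tendsto_log_atTop).congr' ?_
  filter_upwards [eventually_gt_atTop 0] with t ht
  simp only [Function.comp_apply, Real.exp_log ht]

end Limit

/-! ### Simultaneous Diophantine approximation -/

section Dirichlet

/-- Dirichlet's theorem on simultaneous approximation. -/
lemma exists_nat_abs_mul_sub_le {ι : Type*} [Fintype ι] (α : ι → ℝ) {Q : ℕ} (hQ : 0 < Q) :
    ∃ m : ℕ, 0 < m ∧ m ≤ Q ^ Fintype.card ι ∧ ∃ k : ι → ℤ, ∀ i, |m * α i - k i| ≤ 1 / Q := by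
  classical
  have hQ0 : (0 : ℝ) < Q := by exact_mod_cast hQ
  -- Pigeonhole: the Q^|ι| + 1 multiples m = 0, …, Q^|ι| fall into Q^|ι| cubes of side 1/Q.
  have hmaps : Set.MapsTo (fun (m : ℕ) (i : ι) => ⌊Q * Int.fract (m * α i)⌋)
      (Finset.range (Q ^ Fintype.card ι + 1))
      (Fintype.piFinset fun _ : ι => Finset.Ico (0 : ℤ) Q) := by
    intro m _
    simp only [Finset.mem_coe, Fintype.mem_piFinset, Finset.mem_Ico]
    intro i
    refine ⟨Int.floor_nonneg.2 (mul_nonneg hQ0.le (Int.fract_nonneg _)), ?_⟩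
    rw [Int.floor_lt]
    push_cast
    exact mul_lt_of_lt_one_right hQ0 (Int.fract_lt_one _)
  have main (m m' : ℕ) (hm' : m' < Q ^ Fintype.card ι + 1) (hlt : m < m')
      (heq : (fun i => ⌊Q * Int.fract (m * α i)⌋) = fun i => ⌊Q * Int.fract (m' * α i)⌋) :
      ∃ m : ℕ, 0 < m ∧ m ≤ Q ^ Fintype.card ι ∧ ∃ k : ι → ℤ, ∀ i, |m * α i - k i| ≤ 1 / Q := by
    refine ⟨m' - m, by omega, by omega, fun i => ⌊m' * α i⌋ - ⌊m * α i⌋, fun i => ?_⟩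
    have h1 := Int.abs_sub_lt_one_of_floor_eq_floor (congrFun heq i)
    rw [← mul_sub, abs_mul, abs_of_pos hQ0] at h1
    rw [le_div_iff₀ hQ0, mul_comm, abs_sub_comm]
    refine le_trans (le_of_eq ?_) h1.le
    congr 2
    rw [Nat.cast_sub hlt.le, Int.fract, Int.fract]
    push_cast
    ring
  obtain ⟨m, hm, m', hm', hne, heq⟩ := Finset.exists_ne_map_eq_of_card_lt_of_maps_to
    (by simp) hmaps
  rw [Finset.mem_range] at hm hm'
  rcases lt_or_gt_of_ne hne with h | h
  · exact main m m' hm' h heq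
  · exact main m' m hm h heq.symm

variable {A : Type*} [Fintype A]

/-- Dirichlet applied to the |A| - 1 ratios with a ≠ a₀; the ratio for a₀ is 1 and costs nothing. A
fixed m works for every Q only if l a₀ / m is a common divisor, which aperiodicity forbids, so a
large Q excludes all m ≤ M. -/
lemma exists_large_nat_abs_sub_le {l : A → ℝ} (hl : ∀ a, 0 < l a)
    (h : realGcd (Set.range l) = 0) (a₀ : A) (M : ℕ) (Q₀ : ℕ) :
    ∃ m : ℕ, M < m ∧ ∃ Q : ℕ, Q₀ ≤ Q ∧ 0 < Q ∧ m ≤ Q ^ (Fintype.card A - 1) ∧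
      ∃ k : A → ℤ, ∀ a, |m * (l a / l a₀) - k a| ≤ 1 / Q := by
  classical
  have : Nonempty A := ⟨a₀⟩
  have hne : ∀ m ∈ Finset.Icc 1 M, ∀ᶠ Q : ℕ in atTop,
      ¬ ∃ k : A → ℤ, ∀ a, |m * (l a / l a₀) - k a| ≤ 1 / Q := by
    intro m hm
    have hm0 : (0 : ℝ) < m := by exact_mod_cast (Finset.mem_Icc.1 hm).1
    obtain ⟨a, ha⟩ : ∃ a, ∀ k : ℤ, m * (l a / l a₀) ≠ k := by
      by_contra! hc
      refine realGcd_ne_zero hl (div_pos (hl a₀) hm0) (fun a => ?_) h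
      obtain ⟨k, hk⟩ := hc a
      refine ⟨k, ?_⟩
      rw [← hk]
      have := (hl a₀).ne'
      field_simp
    have hpos : 0 < |m * (l a / l a₀) - round (m * (l a / l a₀))| :=
      abs_pos.2 (sub_ne_zero.2 (ha _))
    filter_upwards [tendsto_one_div_atTop_nhds_zero_nat.eventually (gt_mem_nhds hpos)] with Q hQ
    rintro ⟨k, hk⟩
    have := round_le (m * (l a / l a₀)) (k a)
    linarith [hk a]
  obtain ⟨Q, hQ, hQ₀⟩ := (((Finset.eventually_all _).2 hne).and
    (eventually_ge_atTop (max Q₀ 1))).exists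
  have hQ1 : 0 < Q := lt_of_lt_of_le one_pos ((le_max_right _ _).trans hQ₀)
  obtain ⟨m, hm0, hmQ, k, hk⟩ := exists_nat_abs_mul_sub_le
    (fun a : {a // a ≠ a₀} => l a / l a₀) hQ1
  have hk' : ∃ k : A → ℤ, ∀ a, |m * (l a / l a₀) - k a| ≤ 1 / Q := by
    refine ⟨fun a => if ha : a ≠ a₀ then k ⟨a, ha⟩ else m, fun a => ?_⟩
    by_cases ha : a = a₀
    · subst ha
      simp [div_self (hl a).ne']
    · simpa [ha] using hk ⟨a, ha⟩
  refine ⟨m, ?_, Q, (le_max_left _ _).trans hQ₀, hQ1, ?_, hk'⟩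
  · by_contra! hmM
    exact hQ m (Finset.mem_Icc.2 ⟨hm0, hmM⟩) hk'
  · simpa [Fintype.card_subtype_compl] using hmQ

end Dirichlet

/-! ### Zeros of the characteristic equation -/

section Zeros

variable {A : Type*} [Fintype A] [Nonempty A] {p l : A → ℝ}

/-- The sum is 1 - hw up to O(δ), so a quantitative open mapping theorem gives a root with |w| =
O(δ). The displacement to the left is only O(δ²): phases of size O(δ) reduce the real part of the
sum to second order, while Re w = -η raises it by at least a factor 1 + ηh. -/
lemma exists_small_root (hp : ∀ a, 0 < p a) (hs : ∑ a, p a = 1) (hl : ∀ a, 0 < l a) :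
    ∃ K C δ₀ : ℝ, 0 < K ∧ 0 < C ∧ 0 < δ₀ ∧ ∀ δ, 0 < δ → δ ≤ δ₀ → ∀ θ : A → ℝ,
      (∀ a, |θ a| ≤ δ) → ∃ w : ℂ, ‖w‖ ≤ K * δ ∧ -w.re ≤ C * δ ^ 2 ∧
        ∑ a, (p a : ℂ) * Complex.exp (-w * l a + θ a * Complex.I) = 1 := by
  set h := ∑ a, p a * l a with hh
  have hpos : 0 < h := Finset.sum_pos (fun a _ => mul_pos (hp a) (hl a)) Finset.univ_nonempty
  obtain ⟨M, hM⟩ : ∃ M, ∀ a, l a ≤ M := (Finite.bddAbove_range l).imp fun M hM a => hM ⟨a, rfl⟩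
  have hM0 : 0 < M := (hl (Classical.arbitrary A)).trans_le (hM _)
  -- On |w| = Kδ the linear term has size 9δ; two errors of 2δ leave 5δ, and the open mapping radius
  -- 5δ/2 then exceeds |1 - f(0)| ≤ 2δ.
  set K := 9 / h with hK
  have hK0 : 0 < K := by positivity
  set τ := M * K + 1 with hτ
  have hτ1 : 1 ≤ τ := by have := mul_pos hM0 hK0; linarith
  have hsC : ∑ a, (p a : ℂ) = 1 := by exact_mod_cast hs
  -- All exponents have norm at most τδ, and δ ≤ 1/τ² makes the quadratic remainder (τδ)² at most δ.
  refine ⟨K, τ ^ 2 / h, 1 / τ ^ 2, hK0, by positivity, by positivity, fun δ hδ hδ₀ θ hθ => ?_⟩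
  rw [le_div_iff₀ (by positivity)] at hδ₀
  have hτδ : τ * δ ≤ 1 := by nlinarith [mul_le_mul_of_nonneg_right hτ1 hδ.le]
  have hδ1 : δ ≤ 1 := by nlinarith
  set f : ℂ → ℂ := fun w => ∑ a, (p a : ℂ) * Complex.exp (-w * l a + θ a * Complex.I) with hf
  have hfd : Differentiable ℂ f := by
    rw [hf]; fun_prop
  have hz (w : ℂ) (hw : ‖w‖ ≤ K * δ) (a : A) : ‖-w * l a + θ a * Complex.I‖ ≤ τ * δ := by
    calc _ ≤ ‖-w * l a‖ + ‖θ a * Complex.I‖ := norm_add_le _ _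
      _ = ‖w‖ * l a + |θ a| := by simp [abs_of_pos (hl a)]
      _ ≤ (K * δ) * M + δ := by
        gcongr
        · exact (hl a).le
        · exact hM a
        · exact hθ a
      _ = τ * δ := by rw [hτ]; ring
  have hlin (w : ℂ) (hw : ‖w‖ ≤ K * δ) : ‖f w - 1 + h * w‖ ≤ 2 * δ := by
    have e : f w - 1 + h * w = ∑ a, (p a : ℂ) *
        (Complex.exp (-w * l a + θ a * Complex.I) - 1 - (-w * l a + θ a * Complex.I)) +
        ∑ a, (p a : ℂ) * (θ a * Complex.I) := by
      have e1 : f w - 1 = ∑ a, (p a : ℂ) *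
          (Complex.exp (-w * l a + θ a * Complex.I) - 1) := by
        simp_rw [mul_sub, mul_one, Finset.sum_sub_distrib, hsC, hf]
      rw [e1, hh]
      push_cast
      rw [Finset.sum_mul, ← Finset.sum_add_distrib, ← Finset.sum_add_distrib]
      refine Finset.sum_congr rfl fun a _ => ?_
      ring
    rw [e]
    have h1 : ‖∑ a, (p a : ℂ) *
        (Complex.exp (-w * l a + θ a * Complex.I) - 1 - (-w * l a + θ a * Complex.I))‖ ≤ δ := by
      calc _ ≤ ∑ a, p a * δ := norm_sum_le_of_le _ fun a _ => ?_
        _ = δ := by rw [← Finset.sum_mul, hs, one_mul]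
      rw [norm_mul, Complex.norm_real, Real.norm_of_nonneg (hp a).le]
      refine mul_le_mul_of_nonneg_left ?_ (hp a).le
      refine (Complex.norm_exp_sub_one_sub_id_le ((hz w hw a).trans hτδ)).trans ?_
      calc _ ≤ (τ * δ) ^ 2 := by gcongr; exact hz w hw a
        _ = δ * (δ * τ ^ 2) := by ring
        _ ≤ δ * 1 := by gcongr
        _ = δ := mul_one δ
    have h2 : ‖∑ a, (p a : ℂ) * (θ a * Complex.I)‖ ≤ δ := by
      calc _ ≤ ∑ a, p a * δ := norm_sum_le_of_le _ fun a _ => ?_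
        _ = δ := by rw [← Finset.sum_mul, hs, one_mul]
      simp only [norm_mul, Complex.norm_real, Complex.norm_I, mul_one,
        Real.norm_of_nonneg (hp a).le]
      exact mul_le_mul_of_nonneg_left (hθ a) (hp a).le
    linarith [norm_add_le (∑ a, (p a : ℂ) *
        (Complex.exp (-w * l a + θ a * Complex.I) - 1 - (-w * l a + θ a * Complex.I)))
        (∑ a, (p a : ℂ) * (θ a * Complex.I))]
  have h0 : ‖f 0 - 1‖ ≤ 2 * δ := by
    have := hlin 0 (by simp; positivity)
    simpa using this
  have hsphere (w : ℂ) (hw : ‖w‖ = K * δ) : 5 * δ ≤ ‖f w - f 0‖ := by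
    have h1 := hlin w hw.le
    have h2 : ‖(h : ℂ) * w‖ = 9 * δ := by
      rw [norm_mul, Complex.norm_real, Real.norm_of_nonneg hpos.le, hw, hK]
      field_simp
    have e : (h : ℂ) * w = (f w - 1 + h * w) - (f w - f 0) - (f 0 - 1) := by ring
    have h3 := norm_sub_le ((f w - 1 + h * w) - (f w - f 0)) (f 0 - 1)
    have h4 := norm_sub_le (f w - 1 + h * w) (f w - f 0)
    rw [← e, h2] at h3
    linarith
  have hfreq : ∃ᶠ z in 𝓝 (0 : ℂ), f z ≠ f 0 := by
    intro hc
    simp only [not_not] at hc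
    have := AnalyticOnNhd.eqOn_of_preconnected_of_eventuallyEq (f := f) (g := fun _ => f 0)
      (fun z _ => hfd.analyticAt z) analyticOnNhd_const isPreconnected_univ (Set.mem_univ 0) hc
    have h1 := hsphere ((K * δ : ℝ) : ℂ) (by
      rw [Complex.norm_real, Real.norm_of_nonneg (by positivity)])
    have h2 := this (Set.mem_univ ((K * δ : ℝ) : ℂ))
    simp only at h2
    rw [h2, sub_self, norm_zero] at h1
    linarith
  obtain ⟨w, hw, hfw⟩ := hfd.diffContOnCl.ball_subset_image_closedBall (z₀ := 0) (r := K * δ)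
    (ε := 5 * δ) (by positivity) (fun z hz => hsphere z (by simpa using hz)) hfreq
    (show (1 : ℂ) ∈ Metric.ball (f 0) (5 * δ / 2) by
      rw [Metric.mem_ball, dist_comm, dist_eq_norm]; linarith)
  have hw : ‖w‖ ≤ K * δ := by simpa using hw
  refine ⟨w, hw, ?_, hfw⟩
  rcases le_or_gt (-w.re) 0 with hη | hη
  · exact hη.trans (by positivity)
  set η := -w.re with hηdef
  have hcos (a : A) : 1 - (τ * δ) ^ 2 / 2 ≤ Real.cos (θ a - w.im * l a) := by
    refine le_trans ?_ (Real.one_sub_sq_div_two_le_cos)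
    have h1 := (Complex.abs_im_le_norm _).trans (hz w hw a)
    have h2 : (-w * l a + θ a * Complex.I).im = θ a - w.im * l a := by
      simp; ring
    rw [h2] at h1
    have := sq_le_sq' (neg_le_of_abs_le h1) (le_of_abs_le h1)
    linarith
  have hτδ2 : (τ * δ) ^ 2 ≤ 1 := by nlinarith [mul_pos (by linarith : 0 < τ) hδ]
  have hre : ∑ a, p a * (Real.exp (η * l a) * Real.cos (θ a - w.im * l a)) = 1 := by
    have := congrArg Complex.re hfw
    rw [hf] at this
    simp only [Complex.re_sum, Complex.one_re, Complex.re_ofReal_mul, Complex.exp_re] at this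
    rw [← this]
    refine Finset.sum_congr rfl fun a _ => ?_
    have h1 : (-w * l a + θ a * Complex.I).re = η * l a := by simp [hηdef]
    have h2 : (-w * l a + θ a * Complex.I).im = θ a - w.im * l a := by simp; ring
    rw [h1, h2]
  have hlow : (1 + η * h) * (1 - (τ * δ) ^ 2 / 2) ≤ 1 := by
    refine le_trans ?_ hre.le
    calc _ = ∑ a, p a * ((1 + η * l a) * (1 - (τ * δ) ^ 2 / 2)) := by
          rw [hh]
          simp_rw [← mul_assoc, ← Finset.sum_mul, mul_add, mul_one, Finset.sum_add_distrib, hs,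
            Finset.mul_sum]
          congr 2
          exact Finset.sum_congr rfl fun a _ => by ring
      _ ≤ _ := by
          refine Finset.sum_le_sum fun a _ => mul_le_mul_of_nonneg_left ?_ (hp a).le
          refine mul_le_mul ?_ (hcos a) (by linarith) (Real.exp_pos _).le
          linarith [Real.add_one_le_exp (η * l a)]
  have hηh : 0 < η * h := mul_pos hη hpos
  rw [div_mul_eq_mul_div, le_div_iff₀ hpos]
  nlinarith

end Zeros

section Resonances

variable {A : Type*} [Fintype A] [Nontrivial A] {p : A → ℝ}

/-- For y = 2πm/l_{a₀} with m from Dirichlet's theorem, the phases y lₐ are within δ = 2π/Q of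
multiples of 2π, so iy is almost a root and ρ = iy + w is one. The bound m ≤ Q^{|A|-1} converts δ²
into a power of Im ρ. -/
lemma exists_root_near_line (hp : ∀ a, 0 < p a) (hs : ∑ a, p a = 1) (h : period p = 0) :
    ∃ C : ℝ, 0 < C ∧ ∀ Y : ℝ, ∃ ρ : ℂ, Y ≤ ρ.im ∧ |ρ.re| ≤ 1 / 2 ∧
      -ρ.re ≤ C * ρ.im ^ (-(2 / ((Fintype.card A : ℝ) - 1))) ∧
      ∑ a, (p a : ℂ) ^ (1 + ρ) = 1 := by
  have hl : ∀ a, 0 < -Real.log (p a) := fun a =>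
    neg_pos.2 (Real.log_neg (hp a) (lt_one_of_sum_eq_one hp hs a))
  obtain ⟨K, C, δ₀, hK, hC, hδ₀, hroot⟩ := exists_small_root hp hs hl
  obtain ⟨a₀⟩ := (inferInstance : Nonempty A)
  have hl0 := hl a₀
  set L := -Real.log (p a₀) with hL
  have hn : (1 : ℝ) ≤ (Fintype.card A : ℝ) - 1 := by
    have : (2 : ℝ) ≤ Fintype.card A := by exact_mod_cast Fintype.one_lt_card
    linarith
  have hncast : ((Fintype.card A - 1 : ℕ) : ℝ) = (Fintype.card A : ℝ) - 1 := by
    rw [Nat.cast_sub Fintype.card_pos]; simp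
  set n := (Fintype.card A : ℝ) - 1 with hndef
  have hpi := Real.pi_pos
  -- The factor 4π instead of 2π absorbs Im ρ ≤ 2y, so that (L/4π) Im ρ ≤ m ≤ Q^n.
  refine ⟨C * (2 * Real.pi) ^ 2 * (L / (4 * Real.pi)) ^ (-(2 / n)), by positivity, fun Y => ?_⟩
  obtain ⟨Q₀, hQ₀⟩ := exists_nat_ge (2 * Real.pi / min δ₀ (1 / (2 * K)))
  obtain ⟨M, hM⟩ := exists_nat_ge ((max Y 1 + 1) * L / (2 * Real.pi))
  obtain ⟨m, hm, Q, hQQ₀, hQ, hmQ, k, hk⟩ := exists_large_nat_abs_sub_le hl h a₀ M Q₀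
  have hQ0 : (0 : ℝ) < Q := by exact_mod_cast hQ
  set δ := 2 * Real.pi / Q with hδ
  have hδ0 : 0 < δ := by positivity
  have hδle : δ ≤ min δ₀ (1 / (2 * K)) := by
    have h1 : 2 * Real.pi / min δ₀ (1 / (2 * K)) ≤ Q := hQ₀.trans (by exact_mod_cast hQQ₀)
    rw [div_le_iff₀ (by positivity)] at h1
    rw [hδ, div_le_iff₀ hQ0]
    linarith
  set y := 2 * Real.pi * m / L with hy
  have hθ (a : A) : |-(y * -Real.log (p a)) + 2 * Real.pi * k a| ≤ δ := by
    have e : -(y * -Real.log (p a)) + 2 * Real.pi * k a =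
        -(2 * Real.pi * (m * (-Real.log (p a) / L) - k a)) := by
      rw [hy]; ring
    rw [e, abs_neg, abs_mul, abs_of_pos (by positivity), hδ,
      div_eq_mul_one_div (2 * Real.pi)]
    exact mul_le_mul_of_nonneg_left (hk a) (by positivity)
  obtain ⟨w, hw, hwre, hsum⟩ := hroot δ hδ0 (hδle.trans (min_le_left _ _)) _ hθ
  have hwn : ‖w‖ ≤ 1 / 2 := by
    refine hw.trans ?_
    have := hδle.trans (min_le_right _ _)
    rw [le_div_iff₀ (by positivity)] at this
    linarith
  have hwim := abs_le.1 ((Complex.abs_im_le_norm w).trans hwn)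
  have hyY : max Y 1 + 1 ≤ y := by
    have h1 : (max Y 1 + 1) * L / (2 * Real.pi) ≤ m := hM.trans (by exact_mod_cast hm.le)
    rw [div_le_iff₀ (by positivity)] at h1
    rw [hy, le_div_iff₀ hl0]
    linarith
  have hmaxY := le_max_left Y 1
  have hmax1 := le_max_right Y 1
  refine ⟨y * Complex.I + w, ?_, ?_, ?_, ?_⟩
  · simp; linarith
  · simpa using (Complex.abs_re_le_norm w).trans hwn
  · have him : (y * Complex.I + w).im = y + w.im := by simp
    have hre : (y * Complex.I + w).re = w.re := by simp
    rw [him, hre]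
    refine hwre.trans ?_
    rw [mul_assoc, mul_assoc]
    refine mul_le_mul_of_nonneg_left ?_ hC.le
    have hpos : 0 < L / (4 * Real.pi) * (y + w.im) := mul_pos (by positivity) (by linarith)
    rw [← Real.mul_rpow (by positivity) (by linarith), hδ, div_pow, div_eq_mul_inv]
    refine mul_le_mul_of_nonneg_left ?_ (by positivity)
    rw [Real.rpow_neg hpos.le]
    refine inv_anti₀ (by positivity) ?_
    have h1 : L / (4 * Real.pi) * (y + w.im) ≤ (Q : ℝ) ^ n := by
      rw [← hncast, Real.rpow_natCast]
      calc L / (4 * Real.pi) * (y + w.im) ≤ L / (4 * Real.pi) * (2 * y) := by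
            gcongr; linarith
        _ = m := by rw [hy]; field_simp; ring
        _ ≤ _ := by exact_mod_cast hmQ
    calc _ ≤ ((Q : ℝ) ^ n) ^ (2 / n) := Real.rpow_le_rpow hpos.le h1 (by positivity)
      _ = (Q : ℝ) ^ 2 := by
        rw [← Real.rpow_mul hQ0.le, mul_div_cancel₀ _ (by linarith), Real.rpow_two]
  · refine (Finset.sum_congr rfl fun a _ => ?_).trans hsum
    have hpa : (p a : ℂ) ≠ 0 := Complex.ofReal_ne_zero.2 (hp a).ne'
    rw [Complex.cpow_add _ _ hpa, Complex.cpow_one, Complex.cpow_def_of_ne_zero hpa]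
    congr 1
    rw [Complex.exp_eq_exp_iff_exists_int]
    refine ⟨-k a, ?_⟩
    rw [← Complex.ofReal_log (hp a).le]
    push_cast
    ring

end Resonances

/-! ### Lower bounds for the error term -/

section LowerBound

variable {A : Type*} [Fintype A] [Nontrivial A] {p : A → ℝ}

/-- Write M(t)/t = 1/H + R(t) in the truncated identity. The constant contributes a multiple of ∑
(pₐ^{1+ρ} - pₐ) = 1 - 1 = 0, so the integral of g is controlled by R on the windows alone. -/
lemma norm_integral_poissonTail_le (hp : ∀ a, 0 < p a) (hs : ∑ a, p a = 1) {ρ : ℂ}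
    (h1 : |ρ.re| ≤ 1 / 2) (h2 : 1 ≤ ρ.im) (hρ : ∑ a, (p a : ℂ) ^ (1 + ρ) = 1) {x η S : ℝ}
    (hη : 0 ≤ η) (hρη : -ρ.re ≤ η) (hx : ∀ a, 1 ≤ p a * x)
    (hS : ∀ a t, p a * x ≤ t → t ≤ x → |meanSize p t / t - (entropy p)⁻¹| ≤ S) :
    ‖∫ t in (0 : ℝ)..x, (t : ℂ) ^ (-2 - ρ) * poissonTail t‖ ≤ (∑ a, (p a)⁻¹) * (x ^ η * S) := by
  have hre := abs_le.1 h1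
  obtain ⟨a₀⟩ := (inferInstance : Nonempty A)
  have hx0 : 0 < x := by
    by_contra! hc
    have := hx a₀
    nlinarith [hp a₀]
  have hlt (a : A) : p a * x ≤ x :=
    mul_le_of_le_one_left hx0.le (lt_one_of_sum_eq_one hp hs a).le
  have hS0 : 0 ≤ S := (abs_nonneg _).trans (hS a₀ x (hlt a₀) le_rfl)
  have hρ0 : -ρ ≠ 0 := by
    intro h
    have := congrArg Complex.im h
    simp at this
    linarith
  have hr : -1 - ρ ≠ -1 := fun h => hρ0 (by linear_combination h)
  have hpos {a : A} {t : ℝ} (ht : t ∈ Set.uIcc (p a * x) x) : 0 < t := by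
    rw [Set.uIcc_of_le (hlt a)] at ht
    linarith [hx a, ht.1]
  have hzero (a : A) : (0 : ℝ) ∉ Set.uIcc (p a * x) x := fun h => (hpos h).ne' rfl
  have hconst : ∑ a, (p a : ℂ) ^ (1 + ρ) *
      ∫ t in (p a * x)..x, ((entropy p)⁻¹ : ℂ) * (t : ℂ) ^ (-1 - ρ) = 0 := by
    have hterm (a : A) : (p a : ℂ) ^ (1 + ρ) *
        ∫ t in (p a * x)..x, ((entropy p)⁻¹ : ℂ) * (t : ℂ) ^ (-1 - ρ) =
        ((p a : ℂ) ^ (1 + ρ) - p a) * (((entropy p)⁻¹ : ℂ) * (x : ℂ) ^ (-ρ) / (-ρ)) := by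
      have hpa : (p a : ℂ) ≠ 0 := Complex.ofReal_ne_zero.2 (hp a).ne'
      have e1 : (p a : ℂ) ^ (1 + ρ) * (p a : ℂ) ^ (-ρ) = p a := by
        rw [← Complex.cpow_add _ _ hpa, add_neg_cancel_right, Complex.cpow_one]
      rw [intervalIntegral.integral_const_mul, integral_cpow (Or.inr ⟨hr, hzero a⟩),
        show -1 - ρ + 1 = -ρ by ring, Complex.ofReal_mul,
        Complex.mul_cpow_ofReal_nonneg (hp a).le hx0.le, mul_div_assoc', mul_div_assoc',
        mul_div_assoc']
      congr 1
      linear_combination -((entropy p)⁻¹ : ℂ) * (x : ℂ) ^ (-ρ) * e1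
    simp_rw [hterm, ← Finset.sum_mul, Finset.sum_sub_distrib, hρ]
    have : ∑ a, (p a : ℂ) = 1 := by exact_mod_cast hs
    rw [this, sub_self, zero_mul]
  have hsplit (a : A) : ∫ t in (p a * x)..x, (t : ℂ) ^ (-2 - ρ) * meanSize p t =
      (∫ t in (p a * x)..x, ((entropy p)⁻¹ : ℂ) * (t : ℂ) ^ (-1 - ρ)) +
      ∫ t in (p a * x)..x, (t : ℂ) ^ (-1 - ρ) * ((meanSize p t / t - (entropy p)⁻¹ : ℝ) : ℂ) := by
    have hI1 : IntervalIntegrable (fun t : ℝ => ((entropy p)⁻¹ : ℂ) * (t : ℂ) ^ (-1 - ρ)) volume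
        (p a * x) x := (intervalIntegral.intervalIntegrable_cpow (Or.inr (hzero a))).const_mul _
    have hI2 := intervalIntegrable_meanSize hp hs (ρ := ρ) (by linarith)
      (mul_pos (hp a) hx0).le hx0.le
    have e (t : ℝ) (ht : t ∈ Set.uIcc (p a * x) x) :
        (t : ℂ) ^ (-1 - ρ) * ((meanSize p t / t - (entropy p)⁻¹ : ℝ) : ℂ) =
        (t : ℂ) ^ (-2 - ρ) * meanSize p t - ((entropy p)⁻¹ : ℂ) * (t : ℂ) ^ (-1 - ρ) := by
      have ht0 : (t : ℂ) ≠ 0 := Complex.ofReal_ne_zero.2 (hpos ht).ne'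
      rw [show -1 - ρ = -2 - ρ + 1 by ring, Complex.cpow_add _ _ ht0, Complex.cpow_one]
      push_cast
      field_simp
    rw [intervalIntegral.integral_congr e, intervalIntegral.integral_sub hI2 hI1,
      add_sub_cancel]
  rw [← sum_integral_meanSize hp hs (by linarith) hρ hx0.le]
  simp_rw [hsplit, mul_add, Finset.sum_add_distrib, hconst, zero_add]
  rw [Finset.sum_mul]
  refine norm_sum_le_of_le _ fun a _ => ?_
  have hpx : 0 < p a * x := mul_pos (hp a) hx0
  have hbound (t : ℝ) (ht : t ∈ Set.uIoc (p a * x) x) :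
      ‖(t : ℂ) ^ (-1 - ρ) * ((meanSize p t / t - (entropy p)⁻¹ : ℝ) : ℂ)‖ ≤
        (p a * x)⁻¹ * x ^ η * S := by
    rw [Set.uIoc_of_le (hlt a)] at ht
    have ht1 : 1 ≤ t := (hx a).trans ht.1.le
    have ht0 : 0 < t := by linarith
    rw [norm_mul, Complex.norm_real, Complex.norm_cpow_eq_rpow_re_of_pos ht0]
    refine mul_le_mul ?_ (hS a t ht.1.le ht.2) (norm_nonneg _) (by positivity)
    calc t ^ (-1 - ρ).re = t⁻¹ * t ^ (-ρ.re) := by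
          rw [← Real.rpow_neg_one, ← Real.rpow_add ht0]; congr 1
      _ ≤ (p a * x)⁻¹ * x ^ η := by
          refine mul_le_mul (inv_anti₀ hpx ht.1.le) ?_ (by positivity) (by positivity)
          exact (Real.rpow_le_rpow_of_exponent_le ht1 hρη).trans
            (Real.rpow_le_rpow ht0.le ht.2 hη)
  have hint := intervalIntegral.norm_integral_le_of_norm_le_const hbound
  rw [norm_mul]
  have hpn : ‖(p a : ℂ) ^ (1 + ρ)‖ ≤ 1 := by
    rw [Complex.norm_cpow_eq_rpow_re_of_pos (hp a)]
    exact Real.rpow_le_one (hp a).le (lt_one_of_sum_eq_one hp hs a).le (by simp; linarith)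
  calc _ ≤ 1 * ((p a * x)⁻¹ * x ^ η * S * |x - p a * x|) :=
        mul_le_mul hpn hint (norm_nonneg _) zero_le_one
    _ ≤ 1 * ((p a * x)⁻¹ * x ^ η * S * x) := by
        gcongr
        rw [abs_of_nonneg (by linarith [hlt a])]
        linarith
    _ = (p a)⁻¹ * (x ^ η * S) := by
        have := (hp a).ne'
        field_simp

/-- If R were smaller, the window side at x = exp(y^{1+β}) would be O(e^{-5y}), as would the tail
beyond x, against a Gamma quotient of at least e^{-4y}. -/
theorem exists_lt_abs_meanSize_div_sub (hp : ∀ a, 0 < p a) (hs : ∑ a, p a = 1)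
    (h : period p = 0) :
    ∃ C : ℝ, ∀ t₀ : ℝ, ∃ t : ℝ, t₀ < t ∧
      Real.exp (-C * Real.log t ^ (((Fintype.card A : ℝ) - 1) / ((Fintype.card A : ℝ) + 1))) <
        |meanSize p t / t - (entropy p)⁻¹| := by
  obtain ⟨C, hC, hroot⟩ := exists_root_near_line hp hs h
  have hn : (1 : ℝ) ≤ (Fintype.card A : ℝ) - 1 := by
    have : (2 : ℝ) ≤ Fintype.card A := by exact_mod_cast Fintype.one_lt_card
    linarith
  have hn2 : (Fintype.card A : ℝ) + 1 = ((Fintype.card A : ℝ) - 1) + 2 := by ring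
  rw [hn2]
  set n := (Fintype.card A : ℝ) - 1
  set θ := n / (n + 2) with hθ
  set β := 2 / n with hβ
  have hn0 : 0 < n := by linarith
  have hβ0 : 0 < β := by positivity
  have hθ0 : 0 < θ := by positivity
  have hθ1 : θ ≤ 1 := by rw [hθ, div_le_one (by positivity)]; linarith
  have hβθ : (1 + β) * θ = 1 := by rw [hθ, hβ]; field_simp
  refine ⟨2 * (C + 5), ?_⟩
  by_contra! hcon
  obtain ⟨t₀, ht₀⟩ := hcon
  obtain ⟨q, hq0, hqp⟩ : ∃ q, 0 < q ∧ ∀ a, q ≤ p a := by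
    obtain ⟨a, ha⟩ := Finite.exists_min p
    exact ⟨p a, hp a, ha⟩
  set D := ∑ a, (p a)⁻¹ with hD
  have hD0 : 0 ≤ D := Finset.sum_nonneg fun a _ => (inv_pos.2 (hp a)).le
  -- In order: y^β ≥ 10 makes x^{-1/2} ≤ e^{-5y}; y ≥ 2 + D gives the final contradiction; the last
  -- two put the windows at ln t ≥ u/2 and beyond t₀.
  obtain ⟨Y, hY⟩ := eventually_atTop.1 ((((tendsto_rpow_atTop hβ0).eventually
    (eventually_ge_atTop 10)).and (eventually_ge_atTop (2 + D))).and
    ((eventually_ge_atTop (-2 * Real.log q)).and (eventually_ge_atTop (2 * t₀))))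
  obtain ⟨ρ, hρY, hρre, hρη, hρ⟩ := hroot Y
  obtain ⟨⟨hy10, hyD⟩, hyq, hyt⟩ := hY ρ.im hρY
  set y := ρ.im with hy
  have hy1 : 1 ≤ y := by linarith
  have hy0 : 0 < y := by linarith
  -- Chosen so that ηu = Cy and u^θ = y. Halving u costs at most a factor 2 in u^θ, which explains
  -- the 2 in the constant 2(C + 5).
  set u := y ^ (1 + β) with hu
  have hu10 : 10 * y ≤ u := by
    rw [hu, Real.rpow_add hy0, Real.rpow_one, mul_comm]
    exact mul_le_mul_of_nonneg_left hy10 hy0.le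
  have huθ : u ^ θ = y := by rw [hu, ← Real.rpow_mul hy0.le, hβθ, Real.rpow_one]
  set x := Real.exp u with hx
  have hx0 : 0 < x := Real.exp_pos u
  have hlogqx : u / 2 ≤ Real.log (q * x) := by
    rw [Real.log_mul hq0.ne' hx0.ne', hx, Real.log_exp]; linarith
  have hqx : Real.exp (u / 2) ≤ q * x := (Real.le_log_iff_exp_le (by positivity)).1 hlogqx
  have hqt₀ : t₀ < q * x := by linarith [Real.add_one_le_exp (u / 2)]
  have hqx1 : 1 ≤ q * x := (Real.one_le_exp (by linarith)).trans hqx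
  have hpq (a : A) : q * x ≤ p a * x := mul_le_mul_of_nonneg_right (hqp a) hx0.le
  set η := C * y ^ (-β) with hη
  have hη0 : 0 ≤ η := by positivity
  have hxη : x ^ η = Real.exp (C * y) := by
    rw [hx, ← Real.exp_mul]
    congr 1
    rw [hη, hu, mul_left_comm, ← Real.rpow_add hy0, add_neg_cancel_right, Real.rpow_one]
  have hS (a : A) (t : ℝ) (h1 : p a * x ≤ t) (_ : t ≤ x) :
      |meanSize p t / t - (entropy p)⁻¹| ≤ Real.exp (-(C + 5) * y) := by
    have hqt := (hpq a).trans h1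
    refine (ht₀ t (hqt₀.trans_le hqt)).trans (Real.exp_le_exp.2 ?_)
    have hlog : u / 2 ≤ Real.log t := hlogqx.trans (Real.log_le_log (by linarith) hqt)
    have h3 : y / 2 ≤ Real.log t ^ θ := by
      calc y / 2 = u ^ θ * (1 / 2) ^ (1 : ℝ) := by rw [huθ, Real.rpow_one]; ring
        _ ≤ u ^ θ * (1 / 2) ^ θ := by
            rw [huθ]
            refine mul_le_mul_of_nonneg_left ?_ hy0.le
            exact Real.rpow_le_rpow_of_exponent_ge (by norm_num) (by norm_num) hθ1
        _ = (u / 2) ^ θ := by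
            rw [← Real.mul_rpow (by linarith) (by norm_num)]; congr 1; ring
        _ ≤ Real.log t ^ θ := Real.rpow_le_rpow (by linarith) hlog hθ0.le
    nlinarith
  have hup := norm_integral_poissonTail_le hp hs hρre hy1 hρ hη0 hρη
    (fun a => hqx1.trans (hpq a)) hS
  have hre := abs_le.1 hρre
  have hx1 : 1 ≤ x := Real.one_le_exp (by linarith)
  have htail := norm_integral_poissonTail_sub_le (ρ := ρ) (by linarith) (by linarith) hx1
  have hlow := exp_le_norm_Gamma_div (ρ := ρ) (by linarith) hre.2 hy1
  have htri := norm_add_le (Complex.Gamma (1 - ρ) / (1 + ρ) -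
    ∫ t in (0 : ℝ)..x, (t : ℂ) ^ (-2 - ρ) * poissonTail t)
    (∫ t in (0 : ℝ)..x, (t : ℂ) ^ (-2 - ρ) * poissonTail t)
  rw [sub_add_cancel] at htri
  have hxhalf : x ^ (-(1 / 2) : ℝ) ≤ Real.exp (-(5 * y)) := by
    rw [hx, ← Real.exp_mul]
    exact Real.exp_le_exp.2 (by linarith)
  have hprod : x ^ η * Real.exp (-(C + 5) * y) = Real.exp (-(5 * y)) := by
    rw [hxη, ← Real.exp_add]; congr 1; ring
  rw [hprod] at hup
  have hfin : Real.exp (-(4 * y)) ≤ (2 + D) * Real.exp (-(5 * y)) := by linarith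
  have he : Real.exp (-(4 * y)) = Real.exp y * Real.exp (-(5 * y)) := by
    rw [← Real.exp_add]; congr 1; ring
  rw [he, mul_le_mul_iff_left₀ (Real.exp_pos _)] at hfin
  linarith [Real.add_one_le_exp y]

end LowerBound

/-- A function that exceeds `exp (-C (log t)^θ)` at arbitrarily large `t`, for some `θ < 1`, does
not decay like a power. -/
lemma not_isBigO_rpow_neg {R : ℝ → ℝ} {C θ : ℝ} (hθ : θ < 1)
    (hR : ∀ t₀ : ℝ, ∃ t : ℝ, t₀ < t ∧ Real.exp (-C * Real.log t ^ θ) < |R t|) {ε : ℝ}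
    (hε : 0 < ε) : ¬ R =O[atTop] fun t : ℝ => t ^ (-ε) := by
  intro hO
  obtain ⟨c, hc⟩ := hO.bound
  have hlim : Tendsto (fun u : ℝ => -C * u ^ (θ - 1)) atTop (𝓝 (-C * 0)) := by
    have := tendsto_rpow_neg_atTop (y := 1 - θ) (by linarith)
    rw [neg_sub] at this
    exact this.const_mul _
  rw [mul_zero] at hlim
  have hlog := Real.tendsto_log_atTop
  obtain ⟨t₀, ht₀⟩ := eventually_atTop.1 ((hc.and (eventually_gt_atTop 0)).and
    ((hlog.eventually (hlim.eventually (lt_mem_nhds (show -(ε / 2) < 0 by linarith)))).and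
    ((hlog.eventually (eventually_gt_atTop 0)).and
      (hlog.eventually (eventually_ge_atTop (2 / ε * |c|))))))
  obtain ⟨t, ht, hlt⟩ := hR t₀
  obtain ⟨⟨h1, h2⟩, h3, h4, h5⟩ := ht₀ t ht.le
  set u := Real.log t with hu
  have h6 : -(ε / 2) * u < -C * u ^ θ := by
    have : u ^ θ = u ^ (θ - 1) * u := by
      nth_rewrite 3 [← Real.rpow_one u]
      rw [← Real.rpow_add h4]; ring_nf
    rw [this, ← mul_assoc]
    exact mul_lt_mul_of_pos_right h3 h4
  -- One half of the exponent already beats the lower bound for |R|; the other half must then exceed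
  -- 1/c, impossible for large t.
  have h7 : t ^ (-ε) = Real.exp (-(ε / 2) * u) * Real.exp (-(ε / 2) * u) := by
    rw [Real.rpow_def_of_pos h2, ← Real.exp_add]; congr 1; ring
  have h8 := Real.exp_pos (-(ε / 2) * u)
  rw [Real.norm_eq_abs, h7, Real.norm_of_nonneg (by positivity)] at h1
  have h9 := (Real.exp_lt_exp.2 h6).trans (hlt.trans_le h1)
  have h10 : 1 < c * Real.exp (-(ε / 2) * u) := by
    by_contra! hc
    nlinarith
  have h11 : Real.exp (ε / 2 * u) < c := by
    have := mul_lt_mul_of_pos_right h10 (Real.exp_pos (ε / 2 * u))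
    rwa [one_mul, mul_assoc, ← Real.exp_add, neg_mul, neg_add_cancel, Real.exp_zero,
      mul_one] at this
  have h12 : |c| ≤ ε / 2 * u := by
    calc |c| = ε / 2 * (2 / ε * |c|) := by field_simp
      _ ≤ ε / 2 * u := by gcongr
  linarith [Real.add_one_le_exp (ε / 2 * u), le_abs_self c]

/-! ### Tries and prefix counts -/

section Tries

variable {A : Type*}

lemma finite_prefixCount_set (x : ℕ → ℕ → A) (n : ℕ) (v : List A) :
    {k : ℕ | k < n ∧ IsPrefixOf v (x k)}.Finite :=
  (Set.finite_lt_nat n).subset fun _ hk => hk.1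

lemma IsPrefixOf.of_append {v w : List A} {x : ℕ → A} (h : IsPrefixOf (v ++ w) x) :
    IsPrefixOf v x := by
  intro i hi
  rw [← h i (by rw [List.length_append]; omega), List.getElem_append_left hi]

lemma IsPrefixOf.append_singleton {v : List A} {x : ℕ → A} (h : IsPrefixOf v x) :
    IsPrefixOf (v ++ [x v.length]) x := by
  intro i hi
  rw [List.length_append, List.length_singleton] at hi
  rcases Nat.lt_or_ge i v.length with h' | h'
  · rw [List.getElem_append_left h', h i h']
  · obtain rfl : i = v.length := by omega
    simp

lemma prefixCount_append_le (x : ℕ → ℕ → A) (n : ℕ) (v w : List A) :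
    prefixCount x n (v ++ w) ≤ prefixCount x n v :=
  Set.ncard_le_ncard (fun _ hk => ⟨hk.1, hk.2.of_append⟩) (finite_prefixCount_set x n v)

/-- Any string through `v` supplies a child by its next letter. That child is in the trie whatever
its own count, because its parent carries two strings. -/
lemma mem_internalNodes_trie {x : ℕ → ℕ → A} {n : ℕ} {v : List A} :
    v ∈ internalNodes (trie x n) ↔ 2 ≤ prefixCount x n v := by
  constructor
  · rintro ⟨-, a, h | ⟨-, h | h⟩⟩
    · exact h.trans (prefixCount_append_le x n v [a])
    · simp at h
    · rwa [List.dropLast_concat] at h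
  · intro h
    refine ⟨Or.inl h, ?_⟩
    obtain ⟨k, hk⟩ : {k : ℕ | k < n ∧ IsPrefixOf v (x k)}.Nonempty := by
      rw [← Set.ncard_pos (finite_prefixCount_set x n v)]
      exact lt_of_lt_of_le two_pos h
    refine ⟨x k v.length, ?_⟩
    have hpos : 0 < prefixCount x n (v ++ [x k v.length]) :=
      (Set.ncard_pos (finite_prefixCount_set x n _)).2 ⟨k, hk.1, hk.2.append_singleton⟩
    rcases Nat.lt_or_ge 1 (prefixCount x n (v ++ [x k v.length])) with h2 | h2
    · exact Or.inl h2
    · exact Or.inr ⟨by omega, Or.inr (by rwa [List.dropLast_concat])⟩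

lemma internalNodes_trie (x : ℕ → ℕ → A) (n : ℕ) :
    internalNodes (trie x n) = {v | 2 ≤ prefixCount x n v} :=
  Set.ext fun _ => mem_internalNodes_trie

lemma finite_trie [Finite A] {x : ℕ → ℕ → A} {n : ℕ}
    (h : (internalNodes (trie x n)).Finite) : (trie x n).Finite := by
  rw [internalNodes_trie] at h
  refine ((h.union (Set.finite_singleton [])).union
    (Set.Finite.image2 (fun v a => v ++ [a]) h Set.finite_univ)).subset ?_
  rintro v (hv | ⟨-, rfl | hv⟩)
  · exact Or.inl (Or.inl hv)
  · exact Or.inl (Or.inr rfl)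
  · rcases List.eq_nil_or_concat v with rfl | ⟨w, a, rfl⟩
    · exact Or.inl (Or.inr rfl)
    · rw [List.concat_eq_append] at hv ⊢
      rw [List.dropLast_concat] at hv
      exact Or.inr ⟨w, hv, a, Set.mem_univ a, rfl⟩

lemma chi_eq_zero (A : Type*) : chi A = 0 := by
  have : ([] : List A) ∉ internalNodes (rootTree A) := by
    rintro ⟨-, a, h⟩
    simp [rootTree] at h
  simp [chi, sizeToll, this]

variable [MeasurableSpace A] [MeasurableSingletonClass A]

lemma measurableSet_isPrefixOf (v : List A) (k : ℕ) :
    MeasurableSet {x : ℕ → ℕ → A | IsPrefixOf v (x k)} := by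
  have : {x : ℕ → ℕ → A | IsPrefixOf v (x k)} =
      ⋂ i : ℕ, ⋂ hi : i < v.length, (fun x : ℕ → ℕ → A => x k i) ⁻¹' {v[i]} := by
    ext x
    simp [IsPrefixOf, eq_comm]
  rw [this]
  refine MeasurableSet.iInter fun i => MeasurableSet.iInter fun hi => ?_
  exact ((measurable_pi_apply i).comp (measurable_pi_apply k)) (measurableSet_singleton _)

lemma measurable_prefixCount (n : ℕ) (v : List A) :
    Measurable fun x : ℕ → ℕ → A => prefixCount x n v := by
  classical
  have : (fun x : ℕ → ℕ → A => prefixCount x n v) =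
      fun x => ∑ k ∈ Finset.range n, if IsPrefixOf v (x k) then 1 else 0 := by
    ext x
    rw [prefixCount, Finset.sum_boole, Nat.cast_id, ← Set.ncard_coe_finset]
    congr 1
    ext k
    simp
  rw [this]
  exact Finset.measurable_sum _ fun k _ =>
    Measurable.ite (measurableSet_isPrefixOf v k) measurable_const measurable_const

end Tries

/-! ### The law of the prefix counts -/

section Law

lemma measurable_strings {A Ω : Type*} [MeasurableSpace A] [MeasurableSpace Ω]
    {ξ : ℕ → ℕ → Ω → A} (hξ : ∀ k i, Measurable (ξ k i)) : Measurable fun ω k i => ξ k i ω :=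
  measurable_pi_lambda _ fun k => measurable_pi_lambda _ fun i => hξ k i

/-- Poisson thinning in analytic form: mixing the binomial probabilities of at least two successes
over `Po(t)` gives the tail of `Po(tq)`. -/
lemma hasSum_poisson_mul_binomial (t q : ℝ) :
    HasSum (fun n : ℕ => Real.exp (-t) * t ^ n / n.factorial *
      (1 - (1 - q) ^ n - n * q * (1 - q) ^ (n - 1))) (poissonTail (t * q)) := by
  have hexp (y : ℝ) : HasSum (fun n : ℕ => y ^ n / n.factorial) (Real.exp y) := by
    rw [Real.exp_eq_exp_ℝ]; exact NormedSpace.expSeries_div_hasSum_exp y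
  have h1 := (hexp t).mul_left (Real.exp (-t))
  have h2 := (hexp (t * (1 - q))).mul_left (Real.exp (-t))
  have h3 : HasSum (fun n : ℕ => Real.exp (-t) * t ^ n / n.factorial *
      (n * q * (1 - q) ^ (n - 1))) (t * q * (Real.exp (-t) * Real.exp (t * (1 - q)))) := by
    have h4 := h2.mul_left (t * q)
    -- The term n = 0 vanishes through its factor n, so the truncated exponent n - 1 is harmless
    -- there.
    refine (hasSum_nat_add_iff' 1).1 ?_
    simp only [Finset.range_one, Finset.sum_singleton, Nat.cast_zero, zero_mul, mul_zero, sub_zero]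
    refine h4.congr_fun fun n => ?_
    rw [Nat.add_sub_cancel, Nat.factorial_succ, mul_pow, pow_succ]
    push_cast
    have : (n : ℝ) + 1 ≠ 0 := by positivity
    field_simp
  have e1 : Real.exp (-t) * Real.exp t = 1 := by rw [← Real.exp_add]; simp
  have e2 : Real.exp (-t) * Real.exp (t * (1 - q)) = Real.exp (-(t * q)) := by
    rw [← Real.exp_add]; congr 1; ring
  rw [e2] at h2 h3
  rw [e1] at h1
  have h := (h1.sub h2).sub h3
  have e3 : 1 - Real.exp (-(t * q)) - t * q * Real.exp (-(t * q)) = poissonTail (t * q) := by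
    unfold poissonTail; ring
  rw [e3] at h
  refine h.congr_fun fun n => ?_
  rw [mul_pow]
  ring

variable {A : Type*} [Fintype A] [MeasurableSpace A] [MeasurableSingletonClass A] {p : A → ℝ}
  {Ω : Type*} [MeasurableSpace Ω] {μ : Measure Ω} [IsProbabilityMeasure μ] {ξ : ℕ → ℕ → Ω → A}

lemma measure_biInter_isPrefixOf (hp : ∀ a, 0 < p a)
    (hlaw : ∀ k i a, μ.real {ω | ξ k i ω = a} = p a)
    (hind : iIndepFun (fun (ki : ℕ × ℕ) => ξ ki.1 ki.2) μ) (v : List A) (S : Finset ℕ) :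
    μ (⋂ k ∈ S, {ω | IsPrefixOf v fun i => ξ k i ω}) =
      ∏ _k ∈ S, ENNReal.ofReal (stringProb p v) := by
  -- Outside the length of `v` this set is everything, which avoids an index proof in the family of
  -- events.
  set B : ℕ × ℕ → Set A := fun ki => {a | ∀ h : ki.2 < v.length, v[ki.2] = a} with hB
  have hset : (⋂ k ∈ S, {ω | IsPrefixOf v fun i => ξ k i ω}) =
      ⋂ ki ∈ S ×ˢ Finset.range v.length, ξ ki.1 ki.2 ⁻¹' B ki := by
    ext ω
    simp only [Set.mem_iInter, Finset.mem_product, Finset.mem_range, Prod.forall, hB,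
      Set.mem_preimage, Set.mem_ofPred_eq, IsPrefixOf]
    exact ⟨fun h k i hki _ => h k hki.1 i hki.2, fun h k hk i hi => h k i ⟨hk, hi⟩ hi⟩
  rw [hset, hind.measure_inter_preimage_eq_mul (S ×ˢ Finset.range v.length)
    fun ki _ => (Set.toFinite (B ki)).measurableSet, Finset.prod_product]
  refine Finset.prod_congr rfl fun k _ => ?_
  have hval (i : Fin v.length) : μ (ξ k i ⁻¹' B (k, i)) = ENNReal.ofReal (p v[i.1]) := by
    have e : ξ k i ⁻¹' B (k, i) = {ω | ξ k i ω = v[i.1]} := by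
      ext ω; simp [hB, eq_comm]
    rw [e, ← hlaw k i, ofReal_measureReal]
  rw [Finset.prod_range, Finset.prod_congr rfl fun i _ => hval i,
    ← ENNReal.ofReal_prod_of_nonneg fun i _ => (hp _).le]
  congr 1
  exact Fin.prod_univ_fun_getElem v p

lemma iIndepSet_isPrefixOf (hp : ∀ a, 0 < p a) (hξ : ∀ k i, Measurable (ξ k i))
    (hlaw : ∀ k i a, μ.real {ω | ξ k i ω = a} = p a)
    (hind : iIndepFun (fun (ki : ℕ × ℕ) => ξ ki.1 ki.2) μ) (v : List A) :
    iIndepSet (fun k => {ω | IsPrefixOf v fun i => ξ k i ω}) μ := by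
  refine (iIndepSet_iff_meas_biInter (f := fun k => {ω | IsPrefixOf v fun i => ξ k i ω}) fun k =>
    measurable_strings hξ (measurableSet_isPrefixOf v k)).2 fun S => ?_
  rw [measure_biInter_isPrefixOf hp hlaw hind]
  refine Finset.prod_congr rfl fun k _ => ?_
  simpa using (measure_biInter_isPrefixOf hp hlaw hind v {k}).symm

/-- The number of successes among independent events of equal probability is at least two with the
probability given by the binomial distribution. -/
lemma measureReal_two_le_ncard {E : ℕ → Set Ω} (hE : ∀ k, MeasurableSet (E k))
    (hind : iIndepSet E μ) {q : ℝ} (hq : ∀ k, μ.real (E k) = q) (n : ℕ) :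
    μ.real {ω | 2 ≤ Set.ncard {k | k < n ∧ ω ∈ E k}} =
      1 - (1 - q) ^ n - n * q * (1 - q) ^ (n - 1) := by
  classical
  -- Intersecting `F S k` over k < n says that the successes are exactly `S`; fewer than two
  -- successes means `S` is empty or a singleton.
  set F : Finset ℕ → ℕ → Set Ω := fun S k => if k ∈ S then E k else (E k)ᶜ with hF
  have hFm (S : Finset ℕ) (k : ℕ) : MeasurableSet (F S k) := by
    simp only [hF]; split_ifs
    exacts [hE k, (hE k).compl]
  have hFq (S : Finset ℕ) (k : ℕ) : μ.real (F S k) = if k ∈ S then q else 1 - q := by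
    simp only [hF]; split_ifs
    · exact hq k
    · rw [probReal_compl_eq_one_sub (hE k), hq]
  have hprod (S : Finset ℕ) : μ.real (⋂ k ∈ Finset.range n, F S k) =
      ∏ k ∈ Finset.range n, if k ∈ S then q else 1 - q := by
    rw [measureReal_def, (iIndepSet_iff E μ).1 hind (Finset.range n) fun k _ => ?_,
      ENNReal.toReal_prod]
    · exact Finset.prod_congr rfl fun k _ => hFq S k
    · have : MeasurableSet[MeasurableSpace.generateFrom {E k}] (E k) :=
        MeasurableSpace.measurableSet_generateFrom rfl
      simp only [hF]; split_ifs
      exacts [this, this.compl]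
  have hmem (S : Finset ℕ) (hS : S ⊆ Finset.range n) (ω : Ω) :
      ω ∈ ⋂ k ∈ Finset.range n, F S k ↔ {k | k < n ∧ ω ∈ E k} = (S : Set ℕ) := by
    simp only [Set.mem_iInter, Finset.mem_range, hF, Set.ext_iff, Set.mem_ofPred_eq,
      Finset.mem_coe]
    refine forall_congr' fun k => ?_
    by_cases hk : k ∈ S
    · have := Finset.mem_range.1 (hS hk)
      simp [hk, this]
    · simp [hk]
  have hcompl : {ω | 2 ≤ Set.ncard {k | k < n ∧ ω ∈ E k}}ᶜ =
      (⋂ k ∈ Finset.range n, F ∅ k) ∪ ⋃ j ∈ Finset.range n, ⋂ k ∈ Finset.range n, F {j} k := by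
    ext ω
    have hfin : {k | k < n ∧ ω ∈ E k}.Finite := (Set.finite_lt_nat n).subset fun k hk => hk.1
    rw [Set.mem_union, hmem ∅ (Finset.empty_subset _), Set.mem_iUnion₂]
    have h1 : (∃ j, ∃ (_ : j ∈ Finset.range n), ω ∈ ⋂ k ∈ Finset.range n, F {j} k) ↔
        ∃ j, {k | k < n ∧ ω ∈ E k} = {j} := by
      constructor
      · rintro ⟨j, hj, h⟩
        exact ⟨j, by simpa using (hmem {j} (by simpa using hj) ω).1 h⟩
      · rintro ⟨j, h⟩
        have hj : j ∈ {k | k < n ∧ ω ∈ E k} := h ▸ rfl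
        exact ⟨j, Finset.mem_range.2 hj.1, (hmem {j} (by simpa using hj.1) ω).2 (by simpa using h)⟩
    rw [h1, Set.mem_compl_iff, Set.mem_ofPred_eq, not_le, Finset.coe_empty,
      ← Set.ncard_eq_zero hfin, ← Set.ncard_eq_one]
    omega
  have hFim (S : Finset ℕ) : MeasurableSet (⋂ k ∈ Finset.range n, F S k) :=
    Finset.measurableSet_biInter _ fun k _ => hFm S k
  have hdisj (S T : Finset ℕ) (hS : S ⊆ Finset.range n) (hT : T ⊆ Finset.range n) (hST : S ≠ T) :
      Disjoint (⋂ k ∈ Finset.range n, F S k) (⋂ k ∈ Finset.range n, F T k) := by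
    rw [Set.disjoint_left]
    intro ω h1 h2
    rw [hmem S hS] at h1
    rw [hmem T hT, h1] at h2
    exact hST (by exact_mod_cast h2)
  have hmeas : MeasurableSet {ω | 2 ≤ Set.ncard {k | k < n ∧ ω ∈ E k}} := by
    rw [← MeasurableSet.compl_iff, hcompl]
    exact (hFim _).union (Finset.measurableSet_biUnion _ fun j _ => hFim _)
  have hsing (j : ℕ) (hj : j ∈ Finset.range n) :
      μ.real (⋂ k ∈ Finset.range n, F {j} k) = q * (1 - q) ^ (n - 1) := by
    rw [hprod, ← Finset.mul_prod_erase _ _ hj]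
    simp only [Finset.mem_singleton, if_true]
    rw [Finset.prod_congr rfl fun k hk => if_neg (Finset.ne_of_mem_erase hk), Finset.prod_const,
      Finset.card_erase_of_mem hj, Finset.card_range]
  have htot := probReal_compl_eq_one_sub (μ := μ) hmeas
  rw [hcompl, measureReal_union (by
      rw [Set.disjoint_iUnion₂_right]
      intro j hj
      exact hdisj _ _ (Finset.empty_subset _) (by simpa using hj) (Finset.singleton_ne_empty j).symm)
      (Finset.measurableSet_biUnion _ fun j _ => hFim _) (measure_ne_top _ _)
      (measure_ne_top _ _), hprod,
    measureReal_biUnion_finset (fun i hi j hj hij => hdisj _ _ (by simpa using hi)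
      (by simpa using hj) (by simpa using hij)) (fun j _ => hFim _)
      fun j _ => measure_ne_top _ _, Finset.sum_congr rfl hsing] at htot
  simp only [Finset.notMem_empty, if_false, Finset.prod_const, Finset.card_range,
    Finset.sum_const, nsmul_eq_mul] at htot
  linarith

lemma measure_two_le_prefixCount (hp : ∀ a, 0 < p a)
    (hξ : ∀ k i, Measurable (ξ k i))
    (hlaw : ∀ k i a, μ.real {ω | ξ k i ω = a} = p a)
    (hind : iIndepFun (fun (ki : ℕ × ℕ) => ξ ki.1 ki.2) μ)
    {N : Ω → ℕ} (hN : Measurable N) {t : ℝ} (ht : 0 < t)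
    (hNlaw : μ.map N = poissonMeasure t.toNNReal)
    (hNind : IndepFun N (fun ω k i => ξ k i ω) μ) (v : List A) :
    μ {ω | 2 ≤ prefixCount (fun k i => ξ k i ω) (N ω) v} =
      ENNReal.ofReal (poissonTail (t * stringProb p v)) := by
  set D : ℕ → Set (ℕ → ℕ → A) := fun n => {x | 2 ≤ prefixCount x n v} with hD
  have hDm (n : ℕ) : MeasurableSet (D n) := measurable_prefixCount n v measurableSet_Ici
  have hX := measurable_strings hξ
  have hunion : {ω | 2 ≤ prefixCount (fun k i => ξ k i ω) (N ω) v} =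
      ⋃ n, N ⁻¹' {n} ∩ (fun ω k i => ξ k i ω) ⁻¹' D n := by
    ext ω
    simp [hD]
  have hq (k : ℕ) : μ.real {ω | IsPrefixOf v fun i => ξ k i ω} = stringProb p v := by
    have := measure_biInter_isPrefixOf hp hlaw hind v {k}
    simp only [Finset.mem_singleton, Set.iInter_iInter_eq_left, Finset.prod_singleton] at this
    rw [measureReal_def, this, ENNReal.toReal_ofReal (stringProb_pos hp v).le]
  have hbin (n : ℕ) : μ.real ((fun ω k i => ξ k i ω) ⁻¹' D n) =
      1 - (1 - stringProb p v) ^ n - n * stringProb p v * (1 - stringProb p v) ^ (n - 1) :=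
    measureReal_two_le_ncard (fun k => hX (measurableSet_isPrefixOf v k))
      (iIndepSet_isPrefixOf hp hξ hlaw hind v) hq n
  have hterm (n : ℕ) : μ (N ⁻¹' {n} ∩ (fun ω k i => ξ k i ω) ⁻¹' D n) =
      ENNReal.ofReal (Real.exp (-t) * t ^ n / n.factorial * (1 - (1 - stringProb p v) ^ n -
        n * stringProb p v * (1 - stringProb p v) ^ (n - 1))) := by
    rw [hNind.measure_inter_preimage_eq_mul _ _ (measurableSet_singleton n) (hDm n),
      ← Measure.map_apply hN (measurableSet_singleton n), hNlaw, poissonMeasure_singleton,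
      Real.coe_toNNReal t ht.le, ← hbin, ENNReal.ofReal_mul (by positivity), ofReal_measureReal]
  have hsum := hasSum_poisson_mul_binomial t (stringProb p v)
  rw [hunion, measure_iUnion]
  · simp_rw [hterm]
    rw [← ENNReal.ofReal_tsum_of_nonneg _ hsum.summable, hsum.tsum_eq]
    intro n
    rw [← hbin]
    positivity
  · intro m n hmn
    refine Set.disjoint_left.2 fun ω h1 h2 => hmn ?_
    exact h1.1.symm.trans h2.1
  · exact fun n => (hN (measurableSet_singleton n)).inter (hX (hDm n))

end Law

/-! ### The size of the random trie -/

section Size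

variable {A : Type*} [Fintype A] [MeasurableSpace A] [MeasurableSingletonClass A]
  {p : A → ℝ} {Ω : Type*} [MeasurableSpace Ω] {μ : Measure Ω} [IsProbabilityMeasure μ]
  {ξ : ℕ → ℕ → Ω → A}

lemma measurableSet_two_le_prefixCount {A Ω : Type*} [MeasurableSpace A]
    [MeasurableSingletonClass A] [MeasurableSpace Ω] {ξ : ℕ → ℕ → Ω → A}
    (hξ : ∀ k i, Measurable (ξ k i)) {N : Ω → ℕ} (hN : Measurable N) (v : List A) :
    MeasurableSet {ω | 2 ≤ prefixCount (fun k i => ξ k i ω) (N ω) v} := by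
  have hunion : {ω | 2 ≤ prefixCount (fun k i => ξ k i ω) (N ω) v} =
      ⋃ n, N ⁻¹' {n} ∩ (fun ω k i => ξ k i ω) ⁻¹' {x | 2 ≤ prefixCount x n v} := by
    ext ω
    simp
  rw [hunion]
  exact MeasurableSet.iUnion fun n => (hN (measurableSet_singleton n)).inter
    (measurable_strings hξ (measurable_prefixCount n v measurableSet_Ici))

lemma ae_finite_and_integrable_and_integral_size [Nontrivial A] (hp : ∀ a, 0 < p a) (hs : ∑ a, p a = 1)
    (hξ : ∀ k i, Measurable (ξ k i)) (hlaw : ∀ k i a, μ.real {ω | ξ k i ω = a} = p a)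
    (hind : iIndepFun (fun (ki : ℕ × ℕ) => ξ ki.1 ki.2) μ)
    {N : ℝ → Ω → ℕ} {t : ℝ} (hN : Measurable (N t)) (ht : 0 < t)
    (hNlaw : μ.map (N t) = poissonMeasure t.toNNReal)
    (hNind : IndepFun (N t) (fun ω k i => ξ k i ω) μ) :
    (∀ᵐ ω ∂μ, (randomTrie ξ (N t) ω).Finite) ∧
      Integrable (fun ω => (size (randomTrie ξ (N t) ω) : ℝ)) μ ∧
      ∫ ω, (size (randomTrie ξ (N t) ω) : ℝ) ∂μ = meanSize p t := by
  have hm := measurableSet_two_le_prefixCount hξ hN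
  -- The extended count permits Tonelli over nodes before finiteness is known; its finite mean then
  -- yields almost sure finiteness.
  set X : Ω → ENNReal := fun ω => ((internalNodes (randomTrie ξ (N t) ω)).encard : ENNReal) with hX
  have hXsum (ω : Ω) : X ω = ∑' v : List A,
      {ω | 2 ≤ prefixCount (fun k i => ξ k i ω) (N t ω) v}.indicator (fun _ => (1 : ENNReal)) ω := by
    simp only [hX, randomTrie]
    rw [internalNodes_trie, ← ENNReal.tsum_set_one, tsum_subtype _ fun _ => (1 : ENNReal)]
    rfl
  have hXm : Measurable X := by
    simp_rw [funext hXsum]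
    exact Measurable.tsum fun v => measurable_const.indicator (hm v)
  have hint : ∫⁻ ω, X ω ∂μ = ENNReal.ofReal (meanSize p t) := by
    simp_rw [hXsum]
    rw [lintegral_tsum fun v => (measurable_const.indicator (hm v)).aemeasurable]
    simp_rw [lintegral_indicator_const (hm _), one_mul,
      measure_two_le_prefixCount hp hξ hlaw hind hN ht hNlaw hNind]
    rw [meanSize, ENNReal.ofReal_tsum_of_nonneg _ (summable_poissonTail hp hs ht.le)]
    exact fun v => poissonTail_nonneg (mul_nonneg ht.le (stringProb_pos hp v).le)
  have hne : ∫⁻ ω, X ω ∂μ ≠ ⊤ := hint ▸ ENNReal.ofReal_ne_top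
  -- This holds at every ω: for an infinite set, `ncard` and the real value of ⊤ are both 0.
  have hsize : (fun ω => (size (randomTrie ξ (N t) ω) : ℝ)) = fun ω => (X ω).toReal := by
    ext ω
    simp only [hX, size, Set.ncard]
    cases (internalNodes (randomTrie ξ (N t) ω)).encard <;> simp
  refine ⟨?_, ?_, ?_⟩
  · filter_upwards [ae_lt_top hXm hne] with ω hω
    refine finite_trie (Set.encard_lt_top_iff.1 ?_)
    simpa [hX, randomTrie] using hω
  · rw [hsize]
    exact integrable_toReal_of_lintegral_ne_top hXm.aemeasurable hne
  · rw [hsize, integral_toReal hXm.aemeasurable (ae_lt_top hXm hne), hint,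
      ENNReal.toReal_ofReal (meanSize_nonneg hp ht.le)]

lemma tollMean_eq_poissonTail (hp : ∀ a, 0 < p a)
    (hξ : ∀ k i, Measurable (ξ k i)) (hlaw : ∀ k i a, μ.real {ω | ξ k i ω = a} = p a)
    (hind : iIndepFun (fun (ki : ℕ × ℕ) => ξ ki.1 ki.2) μ)
    {N : ℝ → Ω → ℕ} {t : ℝ} (hN : Measurable (N t)) (ht : 0 < t)
    (hNlaw : μ.map (N t) = poissonMeasure t.toNNReal)
    (hNind : IndepFun (N t) (fun ω k i => ξ k i ω) μ) :
    tollMean μ ξ N t = poissonTail t := by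
  have htoll : (fun ω => sizeToll (randomTrie ξ (N t) ω)) =
      {ω | 2 ≤ prefixCount (fun k i => ξ k i ω) (N t ω) []}.indicator fun _ => (1 : ℝ) := by
    ext ω
    simp only [sizeToll, randomTrie, mem_internalNodes_trie, Set.indicator_apply,
      Set.mem_ofPred_eq]
  rw [tollMean, chi_eq_zero, zero_mul, zero_mul, sub_zero, htoll,
    integral_indicator_const _ (measurableSet_two_le_prefixCount hξ hN []), measureReal_def,
    measure_two_le_prefixCount hp hξ hlaw hind hN ht hNlaw hNind, stringProb_nil, mul_one,
    ENNReal.toReal_ofReal (poissonTail_nonneg ht.le), smul_eq_mul, mul_one]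

end Size

end RandomTrie


/-! ### The main theorem -/

theorem mainTheorem12
    {A : Type*} [Fintype A] [Nontrivial A] [MeasurableSpace A] [MeasurableSingletonClass A]
    (p : A → ℝ) (hp_pos : ∀ a, 0 < p a) (hp_sum : ∑ a, p a = 1)
    (hp_aperiodic : RandomTrie.period p = 0)
    {Ω : Type*} [MeasurableSpace Ω] (μ : Measure Ω) [IsProbabilityMeasure μ]
    -- the letters of the random strings are i.i.d. with distribution `p`
    (ξ : ℕ → ℕ → Ω → A)
    (hξ_meas : ∀ k i, Measurable (ξ k i))
    (hξ_law : ∀ k i a, μ.real {ω | ξ k i ω = a} = p a)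
    (hξ_indep : iIndepFun (fun (ki : ℕ × ℕ) => ξ ki.1 ki.2) μ)
    -- for `t > 0`, the number `N t` of strings is `Po(t)` and independent of the strings
    (N : ℝ → Ω → ℕ)
    (hN_meas : ∀ t, 0 < t → Measurable (N t))
    (hN_law : ∀ t, 0 < t → μ.map (N t) = poissonMeasure t.toNNReal)
    (hN_indep : ∀ t, 0 < t → IndepFun (N t) (fun ω k i => ξ k i ω) μ) :
    (∀ t, 0 < t → (∀ᵐ ω ∂μ, (RandomTrie.randomTrie ξ (N t) ω).Finite) ∧
      Integrable (fun ω => (RandomTrie.size (RandomTrie.randomTrie ξ (N t) ω) : ℝ)) μ) ∧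
    RandomTrie.chi A = 0 ∧
    HasMellin (fun t : ℝ => (RandomTrie.tollMean μ ξ N t : ℂ)) (-1) 1 ∧
    ∃ R : ℝ → ℝ,
      (∀ t, 0 < t →
        (∫ ω, (RandomTrie.size (RandomTrie.randomTrie ξ (N t) ω) : ℝ) ∂μ) / t
          = (RandomTrie.entropy p)⁻¹ + R t) ∧
      Tendsto R atTop (𝓝 0) ∧
      (∃ C : ℝ, ∀ t₀ : ℝ, ∃ t : ℝ, t₀ < t ∧
        Real.exp (-C * Real.log t ^
          (((Fintype.card A : ℝ) - 1) / ((Fintype.card A : ℝ) + 1))) < |R t|) ∧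
      (∀ ε : ℝ, 0 < ε → ¬ (R =O[atTop] fun t : ℝ => t ^ (-ε))) := by
  have hmain := fun t ht => RandomTrie.ae_finite_and_integrable_and_integral_size hp_pos hp_sum
    hξ_meas hξ_law hξ_indep (hN_meas t ht) ht (hN_law t ht) (hN_indep t ht)
  have htoll := fun t ht => RandomTrie.tollMean_eq_poissonTail hp_pos
    hξ_meas hξ_law hξ_indep (hN_meas t ht) ht (hN_law t ht) (hN_indep t ht)
  have hlow := RandomTrie.exists_lt_abs_meanSize_div_sub hp_pos hp_sum hp_aperiodic
  refine ⟨fun t ht => ⟨(hmain t ht).1, (hmain t ht).2.1⟩, RandomTrie.chi_eq_zero A, ?_,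
    fun t => RandomTrie.meanSize p t / t - (RandomTrie.entropy p)⁻¹, fun t ht => ?_, ?_, hlow,
    fun ε hε => ?_⟩
  · have h := RandomTrie.hasMellin_poissonTail
    -- The Mellin transform at -1 has weight t^{-2} and sees only t > 0, where the law of `N t` is
    -- prescribed.
    have e : Set.EqOn (fun t : ℝ => (t : ℂ) ^ ((-1 : ℂ) - 1) • (RandomTrie.poissonTail t : ℂ))
        (fun t : ℝ => (t : ℂ) ^ ((-1 : ℂ) - 1) • (RandomTrie.tollMean μ ξ N t : ℂ))
        (Set.Ioi 0) := fun t ht => by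
      simp only [htoll t ht]
    exact ⟨h.1.congr_fun e measurableSet_Ioi,
      (setIntegral_congr_fun measurableSet_Ioi e).symm.trans h.2⟩
  · rw [(hmain t ht).2.2]; ring
  · simpa using (RandomTrie.tendsto_meanSize_div hp_pos hp_sum hp_aperiodic).sub_const
      (RandomTrie.entropy p)⁻¹
  · obtain ⟨C, hC⟩ := hlow
    refine RandomTrie.not_isBigO_rpow_neg ?_ hC hε
    rw [div_lt_one (by positivity)]
    linarith
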